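/- Let $G$ be a finite-dimensional Lie group, let $X$ be a separable Banach manifold and let $Y$ be a second countable Hilbert manifold, both of class $C^k$ with $k\ge 2$ and without boundary. Let $G$ act on $Y$ by an action $G\times Y\to Y$ of class $C^1$. For $y\in Y$ let $D_y\subset T_yY$ be the image of the differential at $1\in G$ of the map $g\mapsto g\cdot y$ (the tangent space at $y$ to the orbit of $y$), and assume that $\dim D_y$ does not depend on $y\in Y$. Let $A\subset X\times Y$ be an open set such that $(x,g\cdot y)\in A$ for all $(x,y)\in A$ and $g\in G$, and let $f:A\to\mathbb R$ be a function of class $C^k$ such that $f(x,g\cdot y)=f(x,y)$ for all $(x,y)\in A$ and $g\in G$. For $x\in X$ put $A_x=\{y\in Y:(x,y)\in A\}$ and $f_x=f(x,\cdot):A_x\to\mathbb R$. At a critical point $y$ of $f_x$ let $\mathrm H^{f_x}(y)$ be the Hessian of $f_x$, a bounded symmetric bilinear form on $T_yY$, also regarded as a bounded linear map $T_yY\to (T_yY)^*$. The function $f_x$ is called $G$-Morse if, for each of its critical points $y\in A_x$, there is a closed complement $W$ of $D_y$ in $T_yY$ on which $\mathrm H^{f_x}(y)$ is strongly nondegenerate,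 i.e. such that $W\to W^*$, $w\mapsto \mathrm H^{f_x}(y)(w,\cdot)|_W$, is an isomorphism. Assume that for every $(x_0,y_0)\in A$ such that $y_0$ is a critical point of $f_{x_0}$: (a) the Hessian $\mathrm H^{f_{x_0}}(y_0)$ is Fredholm; (b) for every $v\in \mathrm{Ker}\big(\mathrm H^{f_{x_0}}(y_0)\big)\setminus D_{y_0}$ there exists $w\in T_{x_0}X$ such that $$\frac{\partial^2 f}{\partial x\,\partial y}(x_0,y_0)(v,w)\ne 0,$$ where the left-hand side is the derivative at $x_0$, in the direction $w$, of the function $x\mapsto \frac{\partial f}{\partial y}(x,y_0)(v)$. Let $\Pi:X\times Y\to X$ be the projection. Then the set of $x\in\Pi(A)$ such that $f_x:A_x\to\mathbb R$ is a $G$-Morse function is generic in $\Pi(A)$, i.e. it contains the intersection of a countable family of dense open subsets of $\Pi(A)$. -/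

import Mathlib

open scoped Manifold ContDiff Topology

noncomputable section

namespace GMorse

/-! Tangent spaces: for a manifold `Y` modelled on `E`, Mathlib's `TangentSpace 𝓘(ℝ, E) y` is the
space `E`, a vector of `E` standing for the tangent vector at `y` that it represents in the
preferred chart `chartAt E y`. All objects below live on `E` through this identification. -/

section OrbitTangent

variable {EG : Type*} [NormedAddCommGroup EG] [NormedSpace ℝ EG]
  (G : Type*) [TopologicalSpace G] [ChartedSpace EG G] [Group G]
  {E : Type*} [NormedAddCommGroup E] [NormedSpace ℝ E]
  {Y : Type*} [TopologicalSpace Y] [ChartedSpace E Y] [MulAction G Y]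

/-- The differential at `1` of the orbit map `g ↦ g • y`, as a map `𝔤 = T₁G → T_y Y`
(note that `1 • y = y`). -/
def orbitDifferential (y : Y) : EG →L[ℝ] E :=
  mfderiv 𝓘(ℝ, EG) 𝓘(ℝ, E) (fun g : G => g • y) 1

/-- The subspace `D_y` of `T_y Y`: the image of the differential at `1` of `g ↦ g • y`, that is,
the tangent space at `y` to the orbit `G • y`. -/
def orbitTangent (EG : Type*) [NormedAddCommGroup EG] [NormedSpace ℝ EG] [ChartedSpace EG G]
    (y : Y) : Submodule ℝ E :=
  LinearMap.range (orbitDifferential (EG := EG) (E := E) G y).toLinearMap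

end OrbitTangent

section Hessian

variable {E : Type*} [NormedAddCommGroup E] [NormedSpace ℝ E]
  {Y : Type*} [TopologicalSpace Y] [ChartedSpace E Y]

/-- The differential `df(y) : T_y Y → ℝ`. -/
def differential (f : Y → ℝ) (y : Y) : E →L[ℝ] ℝ :=
  mfderiv 𝓘(ℝ, E) 𝓘(ℝ, ℝ) f y

/-- `y` is a critical point of `f`: the differential of `f` at `y` vanishes. -/
def IsCritical (E : Type*) [NormedAddCommGroup E] [NormedSpace ℝ E] [ChartedSpace E Y]
    (f : Y → ℝ) (y : Y) : Prop :=
  differential (E := E) f y = 0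

/-- The Hessian of `f` at a critical point `y`, a symmetric bilinear form on `T_y Y`: the second
derivative, at the image of `y`, of `f` read in the preferred chart at `y`. (At a critical point
this bilinear form on the tangent space does not depend on the chart; it is only used there.) -/
def hessian (f : Y → ℝ) (y : Y) : E →L[ℝ] (E →L[ℝ] ℝ) :=
  fderiv ℝ (fderiv ℝ (fun u : E => f ((chartAt E y).symm u))) (chartAt E y y)

/-- A bounded bilinear form `H` is strongly nondegenerate on the subspace `W`: the map
`W → W*`, `w ↦ H(w, ·)`, is an isomorphism. -/
def StronglyNondegenerateOn (H : E →L[ℝ] (E →L[ℝ] ℝ)) (W : Submodule ℝ E) : Prop :=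
  Function.Bijective (fun w : W => ((H (w : E)).comp W.subtypeL : W →L[ℝ] ℝ))

end Hessian

section Morse

variable {EG : Type*} [NormedAddCommGroup EG] [NormedSpace ℝ EG]
  (G : Type*) [TopologicalSpace G] [ChartedSpace EG G] [Group G]
  {E : Type*} [NormedAddCommGroup E] [NormedSpace ℝ E]
  {Y : Type*} [TopologicalSpace Y] [ChartedSpace E Y] [MulAction G Y]

/-- `f` is `G`-nondegenerate at the critical point `y`: the Hessian of `f` at `y` is strongly
nondegenerate on some closed complement of `D_y`. -/
def IsGNondegenerateAt (EG : Type*) [NormedAddCommGroup EG] [NormedSpace ℝ EG] [ChartedSpace EG G]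
    (E : Type*) [NormedAddCommGroup E] [NormedSpace ℝ E] [ChartedSpace E Y]
    (f : Y → ℝ) (y : Y) : Prop :=
  ∃ W : Submodule ℝ E, IsClosed (W : Set E) ∧ IsCompl (orbitTangent (E := E) G EG y) W ∧
    StronglyNondegenerateOn (hessian f y) W

/-- `f` is a `G`-Morse function on the (open, `G`-invariant) set `U`: it is `G`-nondegenerate at
each of its critical points in `U`. The values of `f` outside the open set `U` play no role. -/
def IsGMorseOn (EG : Type*) [NormedAddCommGroup EG] [NormedSpace ℝ EG] [ChartedSpace EG G]
    (E : Type*) [NormedAddCommGroup E] [NormedSpace ℝ E] [ChartedSpace E Y]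
    (f : Y → ℝ) (U : Set Y) : Prop :=
  ∀ y ∈ U, IsCritical E f y → IsGNondegenerateAt G EG E f y

end Morse

section Mixed

variable {EX : Type*} [NormedAddCommGroup EX] [NormedSpace ℝ EX]
  {X : Type*} [TopologicalSpace X] [ChartedSpace EX X]
  {EY : Type*} [NormedAddCommGroup EY] [NormedSpace ℝ EY]
  {Y : Type*} [TopologicalSpace Y] [ChartedSpace EY Y]

/-- The mixed second derivative `∂²f/∂x∂y (x₀, y₀) (v, w)` for `v ∈ T_{y₀} Y`, `w ∈ T_{x₀} X`:
the derivative at `x₀` in the direction `w` of the real-valued function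
`x ↦ ∂f/∂y (x, y₀) v`. -/
def mixedDerivative (f : X × Y → ℝ) (x₀ : X) (y₀ : Y) (v : EY) (w : EX) : ℝ :=
  differential (E := EX) (fun x : X => differential (E := EY) (fun y : Y => f (x, y)) y₀ v) x₀ w

end Mixed

end GMorse

end

noncomputable section

namespace GMorse

open Set Metric MeasureTheory

/-! Work in charts near `(x₀, y₀) ∈ A`. If `y₀` is not critical for `f (x₀, ·)`, there are no
critical points nearby. Otherwise let `D = D_{y₀}`, let `u₀` be the image of `y₀` in the chart, and
let `F` be `f` read in charts. The action moves every point near `y₀` into the slice `u₀ + Dᗮ`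
(`eventually_exists_smul_mem_slice`), so it suffices to study the equation `Φ(p, w) = ∂F/∂u (p, u₀ +
w)|_{Dᗮ} = 0`.

The `w`-derivative of `Φ` at the base point is the Hessian on `Dᗮ`. By symmetry and closed range it
has kernel `K = ker ∩ Dᗮ` and cokernel `K*`, so its index is zero, and (b) makes the `p`-derivative
onto the cokernel. A Lyapunov–Schmidt reduction turns the parameters with a degenerate zero into
critical values of a `C¹` family of maps `K → K` (`isNowhereDense_degenerateParameters`). Between
spaces of equal dimension Sard's theorem needs only `C¹`, so `f` of class `C²` is enough.
Compactness of balls in `K` upgrades measure zero to nowhere dense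
(`isNowhereDense_criticalValues`).

Conversely, let the parameter be good and let `g • y` be a critical point in the slice. The Hessian
at `g • y` has no nonzero kernel vector in `Dᗮ`, so its kernel injects into `D`. At a critical point
the Hessian is a tensor even under `C¹` changes of variables (`fderiv_fderiv_comp_of_critical`),
which is all that the `C¹` action provides. Hence the kernel at `y` has dimension at most `dim D =
dim D_y`. It contains `D_y`, so it equals `D_y`, and the Fredholm property makes the Hessian
strongly nondegenerate on `D_yᗮ`.

Countably many of these local statements suffice, by second countability of chart domains of `X` and
of `Y` (`residual_of_locally_isNowhereDense`). -/

/-! ### Sard's theorem in families and parametric transversality -/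

/-- For a `C¹` family of maps `τ z : K → K`, `z` in a closed ball `B` and `a` in a compact ball, the
critical values of `τ z` form a closed subset of `B × K` with empty interior. -/
theorem isNowhereDense_criticalValues {Z K : Type*}
    [NormedAddCommGroup Z] [NormedSpace ℝ Z]
    [NormedAddCommGroup K] [NormedSpace ℝ K] [FiniteDimensional ℝ K]
    {τ : Z × K → K} {z₀ : Z} {a₀ : K} {r : ℝ}
    (hτ : ∀ z ∈ closedBall z₀ r, ∀ a ∈ closedBall a₀ r, ContDiffAt ℝ 1 τ (z, a)) :
    IsNowhereDense {w : Z × K | w.1 ∈ closedBall z₀ r ∧ ∃ a ∈ closedBall a₀ r,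
      τ (w.1, a) = w.2 ∧
        ((fderiv ℝ τ (w.1, a)).comp (ContinuousLinearMap.inr ℝ Z K)).det = 0} := by
  set D : Z × K → K →L[ℝ] K := fun q =>
    (fderiv ℝ τ q).comp (ContinuousLinearMap.inr ℝ Z K) with hD
  have hDc : ∀ z ∈ closedBall z₀ r, ∀ a ∈ closedBall a₀ r, ContinuousAt D (z, a) := by
    intro z hz a ha
    have h : ContinuousAt (fderiv ℝ τ) (z, a) :=
      (hτ z hz a ha).continuousAt_fderiv (by simp)
    exact h.clm_comp continuousAt_const
  have : CompactSpace (closedBall a₀ r) := isCompact_iff_compactSpace.1 (isCompact_closedBall a₀ r)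
  -- The set is the projection, along a compact ball, of the closed set cut out by two continuous
  -- equations; such a projection is a closed map.
  have hclosed : IsClosed {w : Z × K | w.1 ∈ closedBall z₀ r ∧ ∃ a ∈ closedBall a₀ r,
      τ (w.1, a) = w.2 ∧ (D (w.1, a)).det = 0} := by
    let F : (closedBall a₀ r) × (Z × K) → K × ℝ := fun v =>
      (τ (v.2.1, (v.1 : K)) - v.2.2, (D (v.2.1, (v.1 : K))).det)
    have hB : IsClosed {v : (closedBall a₀ r) × (Z × K) | v.2.1 ∈ closedBall z₀ r} :=
      isClosed_closedBall.preimage (continuous_fst.comp continuous_snd)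
    have hF : ContinuousOn F {v : (closedBall a₀ r) × (Z × K) | v.2.1 ∈ closedBall z₀ r} := by
      intro v hv
      apply ContinuousAt.continuousWithinAt
      have hι : ContinuousAt (fun v : (closedBall a₀ r) × (Z × K) => (v.2.1, (v.1 : K))) v := by
        fun_prop
      have h1 : ContinuousAt (fun v : (closedBall a₀ r) × (Z × K) => τ (v.2.1, (v.1 : K))) v :=
        ContinuousAt.comp' (f := fun v : (closedBall a₀ r) × (Z × K) => (v.2.1, (v.1 : K)))
          (hτ _ hv _ v.1.2).continuousAt hι
      have h2 : ContinuousAt (fun v : (closedBall a₀ r) × (Z × K) => D (v.2.1, (v.1 : K))) v :=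
        ContinuousAt.comp' (f := fun v : (closedBall a₀ r) × (Z × K) => (v.2.1, (v.1 : K)))
          (hDc _ hv _ v.1.2) hι
      refine (h1.sub (by fun_prop)).prodMk ?_
      exact ContinuousAt.comp' (f := fun v : (closedBall a₀ r) × (Z × K) => D (v.2.1, (v.1 : K)))
        ContinuousLinearMap.continuous_det.continuousAt h2
    have hC := hF.preimage_isClosed_of_isClosed hB (isClosed_singleton (x := (0 : K × ℝ)))
    convert isClosedMap_snd_of_compactSpace _ hC using 1
    ext w
    simp only [mem_ofPred_eq, mem_image, mem_inter_iff, mem_preimage, mem_singleton_iff, F,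
      Prod.mk_eq_zero, sub_eq_zero, Prod.exists, Subtype.exists]
    constructor
    · rintro ⟨hz, a, ha, h1, h2⟩
      exact ⟨a, ha, w.1, w.2, ⟨hz, h1, h2⟩, rfl⟩
    · rintro ⟨a, ha, z, t, ⟨hz, h1, h2⟩, rfl⟩
      exact ⟨hz, a, ha, h1, h2⟩
  rw [hclosed.isNowhereDense_iff, eq_empty_iff_forall_notMem]
  rintro ⟨z, t⟩ hw
  let _ : MeasurableSpace K := borel K
  have : BorelSpace K := ⟨rfl⟩
  let μ : Measure K := Measure.addHaar
  have hz : z ∈ closedBall z₀ r := (interior_subset hw).1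
  -- Sard in equal dimensions for the fixed `z`. An interior point `(z, t)` would make this null set
  -- a neighbourhood of `t`, which has positive Haar measure.
  have hnull : μ ((fun a => τ (z, a)) '' {a ∈ closedBall a₀ r | (D (z, a)).det = 0}) = 0 := by
    refine addHaar_image_eq_zero_of_det_fderivWithin_eq_zero μ (f' := fun a => D (z, a)) ?_ ?_
    · rintro a ⟨ha, -⟩
      have h := ((hτ z hz a ha).differentiableAt (by simp)).hasFDerivAt
      exact (h.comp a (hasFDerivAt_prodMk_right z a)).hasFDerivWithinAt
    · rintro a ⟨-, ha⟩
      exact ha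
  have hnhds : (fun a => τ (z, a)) '' {a ∈ closedBall a₀ r | (D (z, a)).det = 0} ∈ 𝓝 t := by
    have h := (Continuous.prodMk_right z).continuousAt.preimage_mem_nhds
      (mem_interior_iff_mem_nhds.1 hw)
    filter_upwards [h] with s hs
    obtain ⟨-, a, ha, h1, h2⟩ := hs
    exact ⟨a, ⟨ha, h2⟩, h1⟩
  exact (Measure.measure_pos_of_mem_nhds μ hnhds).ne' hnull

/-- Local parametric transversality: `Φ (p₀, ·)` has at `m₀` a Fredholm derivative of index zero,
with kernel identified with `K` by `κ` and cokernel by `ρ`, and the `p`-derivative is onto the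
cokernel. Then the parameters `p` near `p₀` for which `Φ (p, ·)` has a zero near `m₀` with a
noninjective derivative form a nowhere dense set. -/
theorem isNowhereDense_degenerateParameters {P M N K : Type*}
    [NormedAddCommGroup P] [NormedSpace ℝ P] [CompleteSpace P]
    [NormedAddCommGroup M] [NormedSpace ℝ M] [CompleteSpace M]
    [NormedAddCommGroup N] [NormedSpace ℝ N] [CompleteSpace N]
    [NormedAddCommGroup K] [NormedSpace ℝ K] [FiniteDimensional ℝ K]
    {Φ : P × M → N} {p₀ : P} {m₀ : M} (hΦ : ContDiffAt ℝ 1 Φ (p₀, m₀)) (h0 : Φ (p₀, m₀) = 0)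
    (ρ : N →L[ℝ] K) (κ : M →L[ℝ] K)
    (hρ : ∀ n, ρ n = 0 ↔ ∃ m, fderiv ℝ Φ (p₀, m₀) (0, m) = n)
    (hκinj : ∀ m, fderiv ℝ Φ (p₀, m₀) (0, m) = 0 → κ m = 0 → m = 0)
    (hκsurj : ∀ a, ∃ m, fderiv ℝ Φ (p₀, m₀) (0, m) = 0 ∧ κ m = a)
    (hρsurj : ∀ t, ∃ p, ρ (fderiv ℝ Φ (p₀, m₀) (p, 0)) = t) :
    ∃ U ∈ 𝓝 p₀, ∃ V ∈ 𝓝 m₀, IsNowhereDense {p | p ∈ U ∧ ∃ m ∈ V, Φ (p, m) = 0 ∧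
      ∃ v : M, v ≠ 0 ∧ fderiv ℝ Φ (p, m) (0, v) = 0} := by
  set Φ' := fderiv ℝ Φ (p₀, m₀) with hΦ'
  have hsplit : ∀ p m, Φ' (p, m) = Φ' (p, 0) + Φ' (0, m) := by
    intro p m
    rw [← map_add]; simp
  -- `π` is onto a finite-dimensional space, hence splits: `p ↦ (π p, ζ p)` identifies `P` with `K ×
  -- ker π`.
  let π : P →L[ℝ] K := ρ.comp (Φ'.comp (ContinuousLinearMap.inl ℝ P M))
  have hπ : ∀ p, π p = ρ (Φ' (p, 0)) := fun p => rfl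
  obtain ⟨ι₀, hι₀⟩ := LinearMap.exists_rightInverse_of_surjective (π : P →ₗ[ℝ] K)
    (LinearMap.range_eq_top.2 hρsurj)
  let ι : K →L[ℝ] P := LinearMap.toContinuousLinearMap ι₀
  have hι : Function.RightInverse ι π := fun t => LinearMap.congr_fun hι₀ t
  let e := ContinuousLinearEquiv.equivOfRightInverse π ι hι
  have he1 : ∀ p, (e p).1 = π p := fun p => rfl
  have he2 : ∀ p, ((e p).2 : P) = p - ι (π p) := fun p => rfl
  have : CompleteSpace π.ker := π.isClosed_ker.completeSpace_coe
  let ζ : P →L[ℝ] π.ker := (ContinuousLinearMap.snd ℝ K π.ker).comp (e : P →L[ℝ] K × π.ker)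
  have hζ : ∀ p, ((ζ p : π.ker) : P) = p - ι (π p) := he2
  -- Lyapunov–Schmidt: adding `κ m` and `ζ p` to the equation makes the derivative at the base point
  -- bijective, so `Θ` is a local diffeomorphism and the zeros of `Φ` are locally `Θ⁻¹(0, a, z)`.
  let Θ : P × M → N × (K × π.ker) := fun q => (Φ q, κ q.2, ζ q.1)
  let R : P × M →L[ℝ] K × π.ker :=
    (κ.comp (ContinuousLinearMap.snd ℝ P M)).prod (ζ.comp (ContinuousLinearMap.fst ℝ P M))
  have hΘ : ∀ q, ContDiffAt ℝ 1 Φ q → ContDiffAt ℝ 1 Θ q := fun q hq =>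
    hq.prodMk R.contDiff.contDiffAt
  have hΘ' : ∀ q, ContDiffAt ℝ 1 Φ q → HasFDerivAt Θ ((fderiv ℝ Φ q).prod R) q := fun q hq =>
    (hq.differentiableAt (by simp)).hasFDerivAt.prodMk R.hasFDerivAt
  have hbij : Function.Bijective (Φ'.prod R) := by
    constructor
    · rw [injective_iff_map_eq_zero]
      rintro ⟨p, m⟩ h
      have h1 : Φ' (p, m) = 0 := congrArg Prod.fst h
      have h2 : κ m = 0 := congrArg (fun x => x.2.1) h
      have h3 : ζ p = 0 := congrArg (fun x => x.2.2) h
      have h4 : π p = 0 := by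
        have : ρ (Φ' (0, m)) = 0 := (hρ _).2 ⟨m, rfl⟩
        have h5 := congrArg ρ h1
        rw [hsplit, map_add, this, add_zero, map_zero] at h5
        exact h5
      have h5 : p = 0 := by
        have := hζ p
        rw [h3, h4] at this
        simpa using this.symm
      subst h5
      rw [hκinj m h1 h2]; rfl
    · rintro ⟨n, a, z⟩
      let p : P := z + ι (ρ n)
      have hzπ : π z = 0 := z.2
      have hp : π p = ρ n := by simp [p, hzπ, hι _]
      obtain ⟨m, hm⟩ := (hρ (n - Φ' (p, 0))).1 (by rw [map_sub, ← hπ, hp, sub_self])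
      obtain ⟨m', hm', hm''⟩ := hκsurj (a - κ m)
      refine ⟨(p, m + m'), ?_⟩
      have h1 : Φ' (p, m + m') = n := by
        have : Φ' (0, m + m') = Φ' (0, m) + Φ' (0, m') := by rw [← map_add]; simp
        rw [hsplit, this, hm, hm']; abel
      have h3 : ζ p = z := by
        apply Subtype.ext
        rw [hζ, hp]
        simp [p]
      change (Φ' (p, m + m'), κ (m + m'), ζ p) = (n, a, z)
      rw [h1, h3, map_add, hm'']; simp
  let E : (P × M) ≃L[ℝ] N × (K × π.ker) := ContinuousLinearEquiv.ofBijective (Φ'.prod R)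
    (LinearMap.ker_eq_bot.2 hbij.1) (LinearMap.range_eq_top.2 hbij.2)
  have hE : HasFDerivAt Θ (E : P × M →L[ℝ] N × (K × π.ker)) (p₀, m₀) := hΘ' _ hΦ
  let L := (hΘ _ hΦ).toOpenPartialHomeomorph Θ hE one_ne_zero
  have hLcoe : ∀ q, L q = Θ q := fun q => rfl
  have hmem : (p₀, m₀) ∈ L.source := (hΘ _ hΦ).mem_toOpenPartialHomeomorph_source hE one_ne_zero
  have hσ0 : ContDiffAt ℝ 1 L.symm (Θ (p₀, m₀)) := (hΘ _ hΦ).to_localInverse hE one_ne_zero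
  have hΘ0 : Θ (p₀, m₀) = (0, κ m₀, ζ p₀) := by simp [Θ, h0]
  let j : π.ker × K →L[ℝ] N × (K × π.ker) := (0 : π.ker × K →L[ℝ] N).prod
    ((ContinuousLinearMap.snd ℝ π.ker K).prod (ContinuousLinearMap.fst ℝ π.ker K))
  have hj : ∀ z a, j (z, a) = (0, a, z) := fun z a => rfl
  let πf : P × M →L[ℝ] K := π.comp (ContinuousLinearMap.fst ℝ P M)
  -- The `π`-coordinate of the parameter of the zero labelled `(z, a)`. Thus zeros of `Φ (p, ·)`
  -- correspond locally to solutions `a` of `τ (ζ p, a) = π p`.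
  let τ : π.ker × K → K := fun w => πf (L.symm (j w))
  have hev : ∀ᶠ w in 𝓝 (ζ p₀, κ m₀), ContDiffAt ℝ 1 L.symm (j w) := by
    have h1 := hσ0.eventually (by simp)
    rw [hΘ0, ← hj] at h1
    exact j.continuous.continuousAt.eventually h1
  obtain ⟨r, hr, hball⟩ := (nhds_basis_closedBall.mem_iff).1 hev
  have hball' : ∀ z ∈ closedBall (ζ p₀) r, ∀ a ∈ closedBall (κ m₀) r,
      ContDiffAt ℝ 1 L.symm (j (z, a)) := by
    intro z hz a ha
    refine hball ?_
    rw [← closedBall_prod_same]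
    exact ⟨hz, ha⟩
  have hτ : ∀ z ∈ closedBall (ζ p₀) r, ∀ a ∈ closedBall (κ m₀) r, ContDiffAt ℝ 1 τ (z, a) := by
    intro z hz a ha
    exact πf.contDiff.contDiffAt.comp _
      (ContDiffAt.comp _ (hball' z hz a ha) j.contDiff.contDiffAt)
  have hnd := isNowhereDense_criticalValues hτ
  let φ : P ≃L[ℝ] π.ker × K := e.trans (ContinuousLinearEquiv.prodComm ℝ K π.ker)
  have hφ : ∀ p, φ p = (ζ p, π p) := fun p => rfl
  have hnear : ∀ᶠ q in 𝓝 (p₀, m₀), q ∈ L.source ∧ ContDiffAt ℝ 1 Φ q ∧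
      ζ q.1 ∈ closedBall (ζ p₀) r ∧ κ q.2 ∈ closedBall (κ m₀) r := by
    refine Filter.Eventually.and (L.open_source.mem_nhds hmem)
      ((hΦ.eventually (by simp)).and (.and ?_ ?_))
    · exact (ζ.continuous.comp continuous_fst).continuousAt.eventually
        (closedBall_mem_nhds (ζ p₀) hr)
    · exact (κ.continuous.comp continuous_snd).continuousAt.eventually
        (closedBall_mem_nhds (κ m₀) hr)
  rw [nhds_prod_eq, Filter.eventually_prod_iff] at hnear
  obtain ⟨pa, hpa, pb, hpb, hab⟩ := hnear
  refine ⟨{p | pa p}, hpa, {m | pb m}, hpb, ?_⟩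
  have hnd' : IsNowhereDense (φ ⁻¹' {w : π.ker × K | w.1 ∈ closedBall (ζ p₀) r ∧
      ∃ a ∈ closedBall (κ m₀) r, τ (w.1, a) = w.2 ∧
        ((fderiv ℝ τ (w.1, a)).comp (ContinuousLinearMap.inr ℝ π.ker K)).det = 0}) := by
    have ho : IsOpenMap φ := φ.toHomeomorph.isOpenMap
    rw [IsNowhereDense, ← ho.preimage_closure_eq_closure_preimage φ.continuous,
      ← ho.preimage_interior_eq_interior_preimage φ.continuous, hnd, preimage_empty]
  refine hnd'.mono ?_
  rintro p ⟨hp, m, hm, hz, v, hv, hv0⟩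
  obtain ⟨hs, hcd, hζp, hκm⟩ := hab hp hm
  have hΘq : Θ (p, m) = j (ζ p, κ m) := by simp [Θ, hz, hj]
  have hinv : L.symm (j (ζ p, κ m)) = (p, m) := by
    rw [← hΘq]; exact L.left_inv hs
  have hcσ := hball' _ hζp _ hκm
  refine ⟨hζp, κ m, hκm, ?_, ?_⟩
  · change πf (L.symm (j (ζ p, κ m))) = π p
    rw [hinv]; rfl
  have hdσ := (hcσ.differentiableAt (by simp)).hasFDerivAt
  set σ' := fderiv ℝ L.symm (j (ζ p, κ m)) with hσ'
  -- Since `Φ'` kills `(0, v)`, the derivative of `Θ` sends it to `(0, κ v, 0)`. The inverse sends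
  -- that back to a vector with no `P`-component, so `κ v` is killed by `∂τ/∂a`; and `κ v = 0` would
  -- force `v = 0`.
  have hid : σ' (0, κ v, 0) = (0, v) := by
    have h1 : HasFDerivAt (fun q => L.symm (Θ q)) (σ'.comp ((fderiv ℝ Φ (p, m)).prod R)) (p, m) :=
      HasFDerivAt.comp (p, m) (by rw [hΘq]; exact hdσ) (hΘ' _ hcd)
    have h2 : HasFDerivAt (fun q => L.symm (Θ q)) (ContinuousLinearMap.id ℝ (P × M)) (p, m) := by
      refine (hasFDerivAt_id _).congr_of_eventuallyEq ?_
      filter_upwards [L.open_source.mem_nhds hs] with q hq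
      exact L.left_inv hq
    have h3 := congrArg (fun f => f (0, v)) (h1.unique h2)
    have h4 : ((fderiv ℝ Φ (p, m)).prod R) (0, v) = (0, κ v, 0) := by
      simp [R, hv0]
    rw [← h4]
    exact h3
  have hdτ : HasFDerivAt τ (πf.comp (σ'.comp j)) (ζ p, κ m) :=
    πf.hasFDerivAt.comp _ (HasFDerivAt.comp (ζ p, κ m) hdσ j.hasFDerivAt)
  by_contra hdet
  have hinj : Function.Injective ((fderiv ℝ τ (ζ p, κ m)).comp
      (ContinuousLinearMap.inr ℝ π.ker K)) :=
    LinearMap.ker_eq_bot.1 (not_not.1 fun h => hdet (LinearMap.det_eq_zero_iff_ker_ne_bot.2 h))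
  have hκv : κ v = 0 := by
    apply hinj
    rw [map_zero, hdτ.fderiv]
    change πf (σ' (0, κ v, 0)) = 0
    rw [hid]
    exact map_zero π
  rw [hκv] at hid
  have : σ' (0, 0, 0) = 0 := map_zero σ'
  rw [this] at hid
  exact hv (congrArg Prod.snd hid).symm

/-! ### Symmetric forms with closed range on a Hilbert space -/

/-- A subspace of a finite-dimensional space with zero orthogonal complement is everything. This
turns transversality, a condition on single kernel vectors, into surjectivity onto the cokernel. -/
theorem surjective_of_forall_inner_eq_zero {P K : Type*} [NormedAddCommGroup P] [NormedSpace ℝ P]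
    [NormedAddCommGroup K] [InnerProductSpace ℝ K] [FiniteDimensional ℝ K] (g : P →L[ℝ] K)
    (hg : ∀ k, (∀ p, inner ℝ (g p) k = 0) → k = 0) : Function.Surjective g := by
  have h : (LinearMap.range (g : P →ₗ[ℝ] K))ᗮ = ⊥ := by
    rw [Submodule.eq_bot_iff]
    intro k hk
    exact hg k fun p => (Submodule.mem_orthogonal _ _).1 hk _ ⟨p, rfl⟩
  exact LinearMap.range_eq_top.1 (Submodule.orthogonal_eq_bot_iff.1 h)

section SymmetricForm

variable {H : Type*} [NormedAddCommGroup H] [InnerProductSpace ℝ H]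

variable (D : Submodule ℝ H) [FiniteDimensional ℝ D]

/-- The difference lies in `Dᗮᗮ`, which is `D` by finite dimension. -/
theorem apply_orthogonalProjectionOnto_eq {V : Type*} [AddCommGroup V] [Module ℝ V] [TopologicalSpace V]
    {B : H →L[ℝ] V} (hD : ∀ v ∈ D, B v = 0) (v : H) :
    B (Dᗮ.orthogonalProjectionOnto v : H) = B v := by
  have h : v - (Dᗮ.orthogonalProjectionOnto v : H) ∈ Dᗮᗮ :=
    Submodule.sub_starProjection_mem_orthogonal v
  rw [Submodule.orthogonal_orthogonal] at h
  have := hD _ h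
  rw [map_sub, sub_eq_zero] at this
  exact this.symm

-- By symmetry `D` is also in the kernel of the second argument, so `B v` only sees the
-- `Dᗮ`-component of its argument.
variable {D} in
theorem eq_zero_of_orthogonal_restriction {B : H →L[ℝ] H →L[ℝ] ℝ} (hsym : ∀ v w, B v w = B w v)
    (hD : ∀ v ∈ D, B v = 0) {v : H} (hv : ∀ w ∈ Dᗮ, B v w = 0) : B v = 0 := by
  ext w
  have h := apply_orthogonalProjectionOnto_eq D (B := B v)
    (fun d hd => by rw [hsym, hD d hd]; rfl) w
  rw [← h]
  exact hv _ (Dᗮ.orthogonalProjectionOnto w).2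

variable [CompleteSpace H]

/-- A symmetric bilinear form with closed range represents every functional that vanishes on its
kernel. -/
theorem exists_eq_of_forall_ker {B : H →L[ℝ] H →L[ℝ] ℝ} (hsym : ∀ v w, B v w = B w v)
    (hclosed : IsClosed (B.range : Set (H →L[ℝ] ℝ))) {l : H →L[ℝ] ℝ}
    (hl : ∀ v, B v = 0 → l v = 0) : ∃ v, B v = l := by
  let J := InnerProductSpace.toDual ℝ H
  have hJ : ∀ (y : H →L[ℝ] ℝ) x, inner ℝ (J.symm y) x = y x := fun y x =>
    InnerProductSpace.toDual_symm_apply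
  -- The range of `B` transported to `H` by Riesz. By symmetry a vector orthogonal to `S` is in the
  -- kernel of `B`; being closed, `S` is its own double orthogonal.
  let S : Submodule ℝ H :=
    { carrier := {z | ∃ v, B v = J z}
      add_mem' := by
        rintro a b ⟨v, hv⟩ ⟨w, hw⟩
        exact ⟨v + w, by rw [map_add, hv, hw, map_add]⟩
      zero_mem' := ⟨0, by simp⟩
      smul_mem' := by
        rintro c a ⟨v, hv⟩
        exact ⟨c • v, by rw [map_smul, hv]; simp⟩ }
  have hS : IsClosed (S : Set H) := by
    have : (S : Set H) = J ⁻¹' (B.range : Set (H →L[ℝ] ℝ)) := rfl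
    rw [this]
    exact hclosed.preimage J.continuous
  have : CompleteSpace S := hS.completeSpace_coe
  have hmem : J.symm l ∈ S := by
    rw [← Submodule.orthogonal_orthogonal S, Submodule.mem_orthogonal']
    intro u hu
    rw [hJ]
    apply hl
    ext v
    rw [hsym, ← hJ (B v) u]
    exact (Submodule.mem_orthogonal _ _).1 hu _ ⟨v, by simp⟩
  obtain ⟨v, hv⟩ := hmem
  exact ⟨v, by simpa using hv⟩

variable {D}

/-- A symmetric bilinear form whose kernel contains `D` represents on `Dᗮ` every functional on `Dᗮ`
that vanishes on the part of its kernel in `Dᗮ`. -/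
theorem exists_mem_orthogonal_eq {B : H →L[ℝ] H →L[ℝ] ℝ} (hsym : ∀ v w, B v w = B w v)
    (hclosed : IsClosed (B.range : Set (H →L[ℝ] ℝ))) (hD : ∀ v ∈ D, B v = 0)
    {l : Dᗮ →L[ℝ] ℝ} (hl : ∀ v : Dᗮ, B v = 0 → l v = 0) :
    ∃ v : Dᗮ, (B v).comp Dᗮ.subtypeL = l := by
  -- Extend `l` by zero on `D`, represent it on all of `H`, then project the representing vector.
  obtain ⟨u, hu⟩ := exists_eq_of_forall_ker hsym hclosed
    (l := l.comp Dᗮ.orthogonalProjectionOnto) (by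
      intro v hv
      exact hl _ ((apply_orthogonalProjectionOnto_eq D hD v).trans hv))
  refine ⟨Dᗮ.orthogonalProjectionOnto u, ?_⟩
  ext w
  rw [apply_orthogonalProjectionOnto_eq D hD, hu]
  simp

/-- A vector of `Dᗮ` in the kernel also lies in `D`, hence is zero. This gives injectivity and
trivialises the solvability condition of `exists_mem_orthogonal_eq`. -/
theorem stronglyNondegenerateOn_orthogonal {B : H →L[ℝ] H →L[ℝ] ℝ} (hsym : ∀ v w, B v w = B w v)
    (hclosed : IsClosed (B.range : Set (H →L[ℝ] ℝ))) (hD : ∀ v, v ∈ D ↔ B v = 0) :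
    StronglyNondegenerateOn B Dᗮ := by
  have hD' : ∀ v ∈ D, B v = 0 := fun v => (hD v).1
  have hker : ∀ v : Dᗮ, B v = 0 → v = 0 := by
    intro v hv
    have h := (Submodule.mem_orthogonal D (v : H)).1 v.2 v ((hD _).2 hv)
    exact Subtype.ext (inner_self_eq_zero.1 h)
  constructor
  · intro v w hvw
    have h : B ((v - w : Dᗮ) : H) = 0 := by
      apply eq_zero_of_orthogonal_restriction hsym hD'
      intro u hu
      have := congrArg (fun l : Dᗮ →L[ℝ] ℝ => l ⟨u, hu⟩) hvw
      simpa [sub_eq_zero] using this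
    exact sub_eq_zero.1 (hker _ h)
  · intro l
    exact exists_mem_orthogonal_eq hsym hclosed hD' fun v hv => by rw [hker v hv, map_zero]

end SymmetricForm

/-! ### Transversality along an affine slice -/

/-- The partial derivative of `F` in the second variable along the affine subspace `u₀ + range s`. -/
def sliceDifferential {P H W : Type*} [NormedAddCommGroup P] [NormedSpace ℝ P]
    [NormedAddCommGroup H] [NormedSpace ℝ H] [NormedAddCommGroup W] [NormedSpace ℝ W]
    (F : P × H → ℝ) (u₀ : H) (s : W →L[ℝ] H) (q : P × W) : W →L[ℝ] ℝ :=
  (fderiv ℝ F (q.1, u₀ + s q.2)).comp ((ContinuousLinearMap.inr ℝ P H).comp s)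

section Slice

variable {P H W : Type*} [NormedAddCommGroup P] [NormedSpace ℝ P]
    [NormedAddCommGroup H] [NormedSpace ℝ H] [NormedAddCommGroup W] [NormedSpace ℝ W]
    {F : P × H → ℝ} {u₀ : H} {s : W →L[ℝ] H}

theorem contDiffAt_sliceDifferential {q : P × W}
    (hF : ContDiffAt ℝ 1 (fderiv ℝ F) (q.1, u₀ + s q.2)) :
    ContDiffAt ℝ 1 (sliceDifferential F u₀ s) q := by
  have hα : ContDiff ℝ 1 (fun q : P × W => (q.1, u₀ + s q.2)) :=
    contDiff_fst.prodMk (contDiff_const.add (s.contDiff.comp contDiff_snd))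
  exact (ContDiffAt.comp q hF hα.contDiffAt).clm_comp contDiffAt_const

theorem fderiv_sliceDifferential {q : P × W}
    (hF : DifferentiableAt ℝ (fderiv ℝ F) (q.1, u₀ + s q.2)) (p : P) (v w : W) :
    fderiv ℝ (sliceDifferential F u₀ s) q (p, v) w =
      fderiv ℝ (fderiv ℝ F) (q.1, u₀ + s q.2) (p, s v) (0, s w) := by
  have hα : HasFDerivAt (fun q : P × W => (q.1, u₀ + s q.2))
      ((ContinuousLinearMap.fst ℝ P W).prod (s.comp (ContinuousLinearMap.snd ℝ P W))) q :=
    hasFDerivAt_fst.prodMk (HasFDerivAt.const_add u₀ (s.hasFDerivAt.comp q hasFDerivAt_snd))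
  have h1 : HasFDerivAt (fun q : P × W => fderiv ℝ F (q.1, u₀ + s q.2)) _ q :=
    HasFDerivAt.comp q hF.hasFDerivAt hα
  have h2 := h1.clm_comp
    (hasFDerivAt_const ((ContinuousLinearMap.inr ℝ P H).comp s) q)
  have h3 : HasFDerivAt (sliceDifferential F u₀ s) _ q := h2
  rw [h3.fderiv]
  simp

end Slice

/-- For a `C²` family `F (p, ·)` of functions on a Hilbert space, whose Hessian at the critical
point `u₀` of `F (p₀, ·)` has kernel containing `D` and is transversal to the parameters off `D`:
the parameters near `p₀` with a degenerate critical point along the slice `u₀ + Dᗮ` are nowhere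
dense. -/
theorem isNowhereDense_degenerateSlice {P H : Type*}
    [NormedAddCommGroup P] [NormedSpace ℝ P] [CompleteSpace P]
    [NormedAddCommGroup H] [InnerProductSpace ℝ H] [CompleteSpace H]
    {F : P × H → ℝ} {p₀ : P} {u₀ : H} (hF : ContDiffAt ℝ 2 F (p₀, u₀))
    (hcrit : ∀ w, fderiv ℝ F (p₀, u₀) (0, w) = 0)
    {D : Submodule ℝ H} [FiniteDimensional ℝ D] {B : H →L[ℝ] H →L[ℝ] ℝ}
    (hBF : ∀ v w, B v w = fderiv ℝ (fderiv ℝ F) (p₀, u₀) (0, v) (0, w))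
    (hsym : ∀ v w, B v w = B w v) (hB : B.IsFredholm) (hD : ∀ v ∈ D, B v = 0)
    (hT : ∀ v, B v = 0 → v ∉ D → ∃ p, fderiv ℝ (fderiv ℝ F) (p₀, u₀) (p, 0) (0, v) ≠ 0) :
    ∃ U ∈ 𝓝 p₀, ∃ V ∈ 𝓝 u₀, IsNowhereDense {p | p ∈ U ∧ ∃ u ∈ V, u - u₀ ∈ Dᗮ ∧
      (∀ w, fderiv ℝ F (p, u) (0, w) = 0) ∧ ∃ v ∈ Dᗮ, v ≠ 0 ∧
        ∀ w, fderiv ℝ (fderiv ℝ F) (p, u) (0, v) (0, w) = 0} := by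
  let Φ : P × Dᗮ → (Dᗮ →L[ℝ] ℝ) := sliceDifferential F u₀ Dᗮ.subtypeL
  have hα0 : (p₀, u₀ + Dᗮ.subtypeL 0) = (p₀, u₀) := by simp
  have hF' : ContDiffAt ℝ 1 (fderiv ℝ F) (p₀, u₀) := hF.fderiv_right (by norm_num)
  have hΦ : ContDiffAt ℝ 1 Φ (p₀, 0) :=
    contDiffAt_sliceDifferential (q := (p₀, 0)) (by rwa [hα0])
  have hΦ0 : ∀ p (v w : Dᗮ), fderiv ℝ Φ (p₀, 0) (p, v) w =
      fderiv ℝ (fderiv ℝ F) (p₀, u₀) (p, v) (0, w) := by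
    intro p v w
    have h := fderiv_sliceDifferential (F := F) (u₀ := u₀) (s := Dᗮ.subtypeL) (q := (p₀, 0))
      (by rw [hα0]; exact hF'.differentiableAt (by simp)) p v w
    rw [hα0] at h
    exact h
  have hΦB : ∀ v : Dᗮ, fderiv ℝ Φ (p₀, 0) (0, v) = (B v).comp Dᗮ.subtypeL := by
    intro v
    ext w
    rw [hΦ0, ← hBF]
    rfl
  have h0 : Φ (p₀, 0) = 0 := by
    ext w
    change fderiv ℝ F (p₀, u₀ + Dᗮ.subtypeL 0) (0, (w : H)) = 0
    rw [hα0, hcrit]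
  let K : Submodule ℝ Dᗮ := (B.comp Dᗮ.subtypeL).ker
  have hK : ∀ v : Dᗮ, v ∈ K ↔ B v = 0 := fun v => Iff.rfl
  have : FiniteDimensional ℝ B.ker := hB.finite_ker
  have : FiniteDimensional ℝ K := by
    let g : K →ₗ[ℝ] B.ker := LinearMap.codRestrict _ (Dᗮ.subtype ∘ₗ K.subtype) fun k => k.2
    refine FiniteDimensional.of_injective g ?_
    intro a b hab
    exact Subtype.ext (Subtype.ext (congrArg (fun x : B.ker => (x : H)) hab))
  -- Restriction to `K` followed by Riesz. Its kernel, the functionals vanishing on `K`, is the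
  -- range of the Hessian on `Dᗮ`.
  let ρ : (Dᗮ →L[ℝ] ℝ) →L[ℝ] K :=
    { toFun := fun l => (InnerProductSpace.toDual ℝ K).symm (l.comp K.subtypeL)
      map_add' := by intro a b; rw [ContinuousLinearMap.add_comp, map_add]
      map_smul' := by intro c a; rw [ContinuousLinearMap.smul_comp]; simp
      cont := (InnerProductSpace.toDual ℝ K).symm.continuous.comp
        ((ContinuousLinearMap.compL ℝ K Dᗮ ℝ).flip K.subtypeL).continuous }
  have hρ : ∀ l (k : K), inner ℝ (ρ l) k = l k := fun l k => InnerProductSpace.toDual_symm_apply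
  have hρ0 : ∀ l, ρ l = 0 ↔ ∀ k : K, l k = 0 := by
    intro l
    constructor
    · intro h k
      rw [← hρ, h, inner_zero_left]
    · intro h
      refine ext_inner_right ℝ fun k => ?_
      rw [hρ, h, inner_zero_left]
  obtain ⟨U, hU, V, hV, hUV⟩ := isNowhereDense_degenerateParameters hΦ h0 ρ K.orthogonalProjectionOnto
    (by
      intro n
      rw [hρ0]
      constructor
      · intro h
        obtain ⟨v, hv⟩ := exists_mem_orthogonal_eq hsym hB.isClosed_range hD (l := n)
          (fun v hv => h ⟨v, hv⟩)
        exact ⟨v, by rw [hΦB, hv]⟩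
      · rintro ⟨m, rfl⟩ k
        rw [hΦB]
        change B m (k : Dᗮ) = 0
        rw [hsym, (hK _).1 k.2]
        rfl)
    (by
      intro m hm hm'
      have h : m ∈ K := by
        rw [hK]
        apply eq_zero_of_orthogonal_restriction hsym hD
        intro w hw
        rw [hΦB] at hm
        exact congrArg (fun l : Dᗮ →L[ℝ] ℝ => l ⟨w, hw⟩) hm
      have h' := Submodule.starProjection_eq_self_iff.2 h
      rw [← h']
      exact congrArg Subtype.val hm')
    (by
      intro a
      refine ⟨a, ?_, Submodule.orthogonalProjectionOnto_mem_subspace_eq_self a⟩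
      rw [hΦB, (hK _).1 a.2]
      rfl)
    (by
      -- A nonzero `k ∈ K` lies in `Dᗮ`, hence not in `D`, so `hT` forbids its being orthogonal to
      -- the range.
      refine surjective_of_forall_inner_eq_zero (P := P) (K := K) (ρ.comp ((fderiv ℝ Φ (p₀, 0)).comp
        (ContinuousLinearMap.inl ℝ P Dᗮ))) ?_
      intro k hk
      by_contra hne
      have hkD : (k : H) ∉ D := by
        intro hkD
        have h := (Submodule.mem_orthogonal D _).1 (k : Dᗮ).2 _ hkD
        exact hne (Subtype.ext (Subtype.ext (inner_self_eq_zero.1 h)))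
      obtain ⟨p, hp⟩ := hT k ((hK _).1 k.2) hkD
      apply hp
      have h2 : inner ℝ (ρ (fderiv ℝ Φ (p₀, 0) (p, 0))) k = 0 := hk p
      rw [hρ, hΦ0] at h2
      exact h2)
  have hnear : ∀ᶠ q in 𝓝 (p₀, u₀), DifferentiableAt ℝ (fderiv ℝ F) q :=
    (hF'.eventually (by simp)).mono fun q hq => hq.differentiableAt (by simp)
  rw [nhds_prod_eq, Filter.eventually_prod_iff] at hnear
  obtain ⟨pa, hpa, pb, hpb, hab⟩ := hnear
  have hV' : {u : H | Dᗮ.orthogonalProjectionOnto (u - u₀) ∈ V} ∈ 𝓝 u₀ := by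
    have hc : Continuous fun u : H => Dᗮ.orthogonalProjectionOnto (u - u₀) := by fun_prop
    exact hc.continuousAt.preimage_mem_nhds (by simpa using hV)
  refine ⟨U ∩ {p | pa p}, Filter.inter_mem hU hpa, _, Filter.inter_mem hV' hpb, hUV.mono ?_⟩
  rintro p ⟨⟨hpU, hp⟩, u, ⟨huV, hu⟩, huD, hc, v, hvD, hv0, hv⟩
  have hproj : Dᗮ.orthogonalProjectionOnto (u - u₀) = ⟨u - u₀, huD⟩ :=
    Submodule.orthogonalProjectionOnto_mem_subspace_eq_self (⟨u - u₀, huD⟩ : Dᗮ)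
  have hαu : (p, u₀ + Dᗮ.subtypeL ⟨u - u₀, huD⟩) = (p, u) := by simp
  refine ⟨hpU, ⟨u - u₀, huD⟩, hproj ▸ huV, ?_, ⟨v, hvD⟩, ?_, ?_⟩
  · ext w
    change fderiv ℝ F (p, u₀ + Dᗮ.subtypeL ⟨u - u₀, huD⟩) (0, (w : H)) = 0
    rw [hαu, hc]
  · exact fun h => hv0 (congrArg Subtype.val h)
  · ext w
    have h := fderiv_sliceDifferential (F := F) (u₀ := u₀) (s := Dᗮ.subtypeL)
      (q := (p, ⟨u - u₀, huD⟩)) (by rw [hαu]; exact hab hp hu) 0 ⟨v, hvD⟩ w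
    rw [hαu] at h
    exact h.trans (hv w)

/-! ### Second derivatives at critical points and partial derivatives -/

section Calculus

variable {E E' E'' V : Type*} [NormedAddCommGroup E] [NormedSpace ℝ E]
  [NormedAddCommGroup E'] [NormedSpace ℝ E'] [NormedAddCommGroup E''] [NormedSpace ℝ E'']
  [NormedAddCommGroup V] [NormedSpace ℝ V]

/-- Product rule for a composition of operators when the left factor vanishes at the point: the right
factor only has to be continuous. -/
theorem hasFDerivAt_clm_comp_of_eq_zero {A : E → E' →L[ℝ] V} {B : E → E'' →L[ℝ] E'} {q : E}
    {A' : E →L[ℝ] E' →L[ℝ] V} (hA : HasFDerivAt A A' q) (hA0 : A q = 0) (hB : ContinuousAt B q) :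
    HasFDerivAt (fun u => (A u).comp (B u))
      (((ContinuousLinearMap.compL ℝ E'' E' V).flip (B q)).comp A') q := by
  have h1 : HasFDerivAt (fun u => (A u).comp (B q))
      (((ContinuousLinearMap.compL ℝ E'' E' V).flip (B q)).comp A') q :=
    ((ContinuousLinearMap.compL ℝ E'' E' V).flip (B q)).hasFDerivAt.comp q hA
  have hAO : A =O[𝓝 q] fun u => u - q := by
    have := hA.isBigO_sub
    simpa [hA0] using this
  have hBo : (fun u => B u - B q) =o[𝓝 q] fun _ => (1 : ℝ) := by
    rw [Asymptotics.isLittleO_one_iff]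
    simpa using hB.sub_const (B q)
  -- `A u = O(u - q)` because `A q = 0`, and `B u - B q = o(1)` by continuity alone; the product is
  -- `o(u - q)`.
  have h2 : HasFDerivAt (fun u => (A u).comp (B u - B q)) (0 : E →L[ℝ] E'' →L[ℝ] V) q := by
    rw [hasFDerivAt_iff_isLittleO]
    have h3 : (fun u => (A u).comp (B u - B q)) =O[𝓝 q] fun u => ‖A u‖ * ‖B u - B q‖ :=
      Asymptotics.IsBigO.of_bound 1 (Filter.Eventually.of_forall fun u => by
        simpa using (A u).opNorm_comp_le (B u - B q))
    have h4 : (fun u => ‖A u‖ * ‖B u - B q‖) =o[𝓝 q] fun u => ‖u - q‖ * (1 : ℝ) :=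
      hAO.norm_norm.mul_isLittleO hBo.norm_left
    have h5 := h3.trans_isLittleO h4
    simp only [mul_one] at h5
    simpa [hA0] using h5.of_norm_right
  have h3 := h1.add h2
  rw [add_zero] at h3
  refine h3.congr_of_eventuallyEq (Filter.Eventually.of_forall fun u => ?_)
  simp [ContinuousLinearMap.comp_sub]

/-- At a critical point the second derivative is a tensor, even under `C¹` changes of variables. -/
theorem fderiv_fderiv_comp_of_critical {h : E' → ℝ} {θ : E → E'} {q : E}
    (hθ : ContDiffAt ℝ 1 θ q) (hh : ContDiffAt ℝ 2 h (θ q)) (hcrit : fderiv ℝ h (θ q) = 0)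
    (v w : E) :
    fderiv ℝ (fderiv ℝ (fun u => h (θ u))) q v w =
      fderiv ℝ (fderiv ℝ h) (θ q) (fderiv ℝ θ q v) (fderiv ℝ θ q w) := by
  have hev : fderiv ℝ (fun u => h (θ u)) =ᶠ[𝓝 q]
      fun u => (fderiv ℝ h (θ u)).comp (fderiv ℝ θ u) := by
    have h1 : ∀ᶠ u in 𝓝 q, ContDiffAt ℝ 2 h (θ u) :=
      hθ.continuousAt.eventually (hh.eventually (by simp))
    filter_upwards [h1, hθ.eventually (by simp)] with u hu hu'
    exact fderiv_comp u (hu.differentiableAt (by simp)) (hu'.differentiableAt (by simp))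
  have hd : DifferentiableAt ℝ (fderiv ℝ h) (θ q) :=
    (hh.fderiv_right (m := 1) (by norm_num)).differentiableAt (by simp)
  have hA : HasFDerivAt (fun u => fderiv ℝ h (θ u))
      ((fderiv ℝ (fderiv ℝ h) (θ q)).comp (fderiv ℝ θ q)) q :=
    HasFDerivAt.comp q hd.hasFDerivAt (hθ.differentiableAt (by simp)).hasFDerivAt
  rw [hev.fderiv_eq,
    (hasFDerivAt_clm_comp_of_eq_zero hA hcrit (hθ.continuousAt_fderiv (by simp))).fderiv]
  rfl

theorem fderiv_partial_right {F : E × E' → ℝ} {p : E} {u : E'}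
    (hF : DifferentiableAt ℝ F (p, u)) :
    fderiv ℝ (fun u => F (p, u)) u =
      (fderiv ℝ F (p, u)).comp (ContinuousLinearMap.inr ℝ E E') :=
  (hF.hasFDerivAt.comp u (hasFDerivAt_prodMk_right p u)).fderiv

theorem fderiv_fderiv_partial_right {F : E × E' → ℝ} {p : E} {u : E'}
    (hF : ContDiffAt ℝ 2 F (p, u)) (v w : E') :
    fderiv ℝ (fderiv ℝ (fun u => F (p, u))) u v w =
      fderiv ℝ (fderiv ℝ F) (p, u) (0, v) (0, w) := by
  have hev : fderiv ℝ (fun u => F (p, u)) =ᶠ[𝓝 u]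
      fun u => (fderiv ℝ F (p, u)).comp (ContinuousLinearMap.inr ℝ E E') := by
    have h1 : ∀ᶠ u' in 𝓝 u, ContDiffAt ℝ 2 F (p, u') :=
      (Continuous.prodMk_right p).continuousAt.eventually (hF.eventually (by simp))
    filter_upwards [h1] with u' hu'
    exact fderiv_partial_right (hu'.differentiableAt (by simp))
  have hd : DifferentiableAt ℝ (fderiv ℝ F) (p, u) :=
    (hF.fderiv_right (m := 1) (by norm_num)).differentiableAt (by simp)
  have h1 : HasFDerivAt (fun u => fderiv ℝ F (p, u)) _ u :=
    hd.hasFDerivAt.comp u (hasFDerivAt_prodMk_right p u)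
  rw [hev.fderiv_eq, (h1.clm_comp (hasFDerivAt_const _ u)).fderiv]
  simp

end Calculus

/-! ### Critical points and group actions in charts -/

section Manifold

variable {E : Type*} [NormedAddCommGroup E] [NormedSpace ℝ E]
  {Y : Type*} [TopologicalSpace Y] [ChartedSpace E Y]

theorem differential_eq_fderiv {φ : Y → ℝ} {y : Y} (hφ : MDifferentiableAt 𝓘(ℝ, E) 𝓘(ℝ, ℝ) φ y) :
    differential φ y = fderiv ℝ (fun u : E => φ ((chartAt E y).symm u)) (chartAt E y y) := by
  have h : HasFDerivWithinAt (writtenInExtChartAt 𝓘(ℝ, E) 𝓘(ℝ, ℝ) y φ)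
    (differential φ y : E →L[ℝ] ℝ) (range 𝓘(ℝ, E)) (extChartAt 𝓘(ℝ, E) y y) := hφ.hasMFDerivAt.2
  simp only [mfld_simps] at h
  rw [hasFDerivWithinAt_univ] at h
  exact h.fderiv.symm

theorem contMDiff_smul_of_group (EG E G Y : Type*) [NormedAddCommGroup EG] [NormedSpace ℝ EG]
    [NormedAddCommGroup E] [NormedSpace ℝ E] [TopologicalSpace G] [ChartedSpace EG G] [Group G]
    [TopologicalSpace Y] [ChartedSpace E Y] [MulAction G Y]
    [ContMDiffSMul 𝓘(ℝ, EG) 𝓘(ℝ, E) 1 G Y] :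
    ContMDiff (𝓘(ℝ, EG).prod 𝓘(ℝ, E)) 𝓘(ℝ, E) 1 (fun p : G × Y => p.1 • p.2) :=
  ContMDiffSMul.contMDiff_smul

theorem contMDiff_smul_left (EG E : Type*) [NormedAddCommGroup EG] [NormedSpace ℝ EG]
    [NormedAddCommGroup E] [NormedSpace ℝ E] {G Y : Type*} [TopologicalSpace G] [ChartedSpace EG G]
    [Group G] [TopologicalSpace Y] [ChartedSpace E Y] [MulAction G Y]
    [ContMDiffSMul 𝓘(ℝ, EG) 𝓘(ℝ, E) 1 G Y] (g : G) :
    ContMDiff 𝓘(ℝ, E) 𝓘(ℝ, E) 1 (fun y : Y => g • y) :=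
  (contMDiff_smul_of_group EG E G Y).comp (contMDiff_const.prodMk contMDiff_id)

/-- Near `g • y` the function equals its composite with `g⁻¹`, so the chain rule carries the
vanishing differential from `y` to `g • y`. -/
theorem IsCritical.smul {G : Type*} [Group G] [MulAction G Y]
    (hs : ∀ g : G, ContMDiff 𝓘(ℝ, E) 𝓘(ℝ, E) 1 (fun y : Y => g • y))
    {φ : Y → ℝ} {U : Set Y} (hU : IsOpen U)
    (hUG : ∀ (g : G), ∀ y ∈ U, g • y ∈ U) (hφG : ∀ (g : G), ∀ y ∈ U, φ (g • y) = φ y) {y : Y}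
    (hy : y ∈ U) (hφ : MDifferentiableAt 𝓘(ℝ, E) 𝓘(ℝ, ℝ) φ y) (hc : IsCritical E φ y) (g : G) :
    IsCritical E φ (g • y) := by
  have hg : MDifferentiableAt 𝓘(ℝ, E) 𝓘(ℝ, E) (fun z : Y => g⁻¹ • z) (g • y) :=
    (hs g⁻¹).mdifferentiableAt (by simp)
  have hev : φ =ᶠ[𝓝 (g • y)] φ ∘ fun z : Y => g⁻¹ • z := by
    filter_upwards [hU.mem_nhds (hUG g y hy)] with z hz
    exact (hφG g⁻¹ z hz).symm
  have hinv : g⁻¹ • g • y = y := inv_smul_smul g y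
  rw [← hinv] at hφ hc
  have h2 := mfderiv_comp (g • y) hφ hg
  rw [show mfderiv 𝓘(ℝ, E) 𝓘(ℝ, ℝ) φ (g⁻¹ • g • y) = 0 from hc] at h2
  rw [ContinuousLinearMap.zero_comp] at h2
  change mfderiv 𝓘(ℝ, E) 𝓘(ℝ, ℝ) φ (g • y) = 0
  rw [hev.mfderiv_eq]
  exact h2

/-- The action of `G` on the manifold `Y`, read in the preferred charts at `1` and `y₀`. -/
def chartAction (E EG G : Type*) {Y : Type*} [NormedAddCommGroup EG] [NormedAddCommGroup E]
    [TopologicalSpace G] [ChartedSpace EG G] [Group G] [TopologicalSpace Y] [ChartedSpace E Y]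
    [MulAction G Y] (y₀ : Y) (q : EG × E) : E :=
  chartAt E y₀ ((chartAt EG (1 : G)).symm q.1 • (chartAt E y₀).symm q.2)

section Action

variable (E) (EG : Type*) [NormedAddCommGroup EG] [NormedSpace ℝ EG]
  (G : Type*) [TopologicalSpace G] [ChartedSpace EG G] [Group G]
  [MulAction G Y] [ContMDiffSMul 𝓘(ℝ, EG) 𝓘(ℝ, E) 1 G Y]

theorem contDiffAt_chartAction (y₀ : Y) :
    ContDiffAt ℝ 1 (chartAction E EG G y₀) (chartAt EG (1 : G) 1, chartAt E y₀ y₀) := by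
  have h := contMDiff_smul_of_group EG E G Y ((1 : G), y₀)
  rw [contMDiffAt_iff] at h
  have h2 := h.2
  simp only [mfld_simps, one_smul] at h2
  rw [Prod.map_id, range_id, contDiffWithinAt_univ] at h2
  exact h2

theorem hasFDerivAt_chartAction_left (y₀ : Y) :
    HasFDerivAt (fun t => chartAction E EG G y₀ (t, chartAt E y₀ y₀))
      (orbitDifferential (EG := EG) (E := E) G y₀) (chartAt EG (1 : G) 1) := by
  have h1 : MDifferentiableAt 𝓘(ℝ, EG) 𝓘(ℝ, E) (fun g : G => g • y₀) 1 := by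
    have h := (contMDiff_smul_of_group EG E G Y).comp
      (contMDiff_id.prodMk contMDiff_const : ContMDiff 𝓘(ℝ, EG) (𝓘(ℝ, EG).prod 𝓘(ℝ, E)) 1
        (fun g : G => (g, y₀)))
    exact h.mdifferentiableAt (by simp)
  have h : HasFDerivWithinAt (writtenInExtChartAt 𝓘(ℝ, EG) 𝓘(ℝ, E) 1 (fun g : G => g • y₀))
    (orbitDifferential (EG := EG) (E := E) G y₀) (range 𝓘(ℝ, EG))
    (extChartAt 𝓘(ℝ, EG) (1 : G) 1) := h1.hasMFDerivAt.2
  simp only [mfld_simps, one_smul] at h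
  rw [hasFDerivWithinAt_univ] at h
  refine h.congr_of_eventuallyEq (Filter.Eventually.of_forall fun t => ?_)
  simp [chartAction]

end Action

variable [IsManifold 𝓘(ℝ, E) 2 Y]

theorem contDiffAt_comp_chart_symm {φ : Y → ℝ} {y₀ : Y} {u : E} (hu : u ∈ (chartAt E y₀).target)
    (hφ : ContMDiffAt 𝓘(ℝ, E) 𝓘(ℝ, ℝ) 2 φ ((chartAt E y₀).symm u)) :
    ContDiffAt ℝ 2 (fun u : E => φ ((chartAt E y₀).symm u)) u := by
  rw [← contMDiffAt_iff_contDiffAt]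
  exact hφ.comp u ((contMDiffOn_chart_symm (I := 𝓘(ℝ, E)) (n := 2) (x := y₀)).contMDiffAt
    ((chartAt E y₀).open_target.mem_nhds hu))

/-- Criticality is defined by the chart centred at `y`; this lets all critical points near `y₀` be
treated in the single chart at `y₀`. -/
theorem fderiv_comp_chart_symm_eq_zero {φ : Y → ℝ} {y₀ y : Y} (hy : y ∈ (chartAt E y₀).source)
    (hφ : MDifferentiableAt 𝓘(ℝ, E) 𝓘(ℝ, ℝ) φ y) (hc : IsCritical E φ y) :
    fderiv ℝ (fun u : E => φ ((chartAt E y₀).symm u)) (chartAt E y₀ y) = 0 := by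
  set u := chartAt E y₀ y with hu
  have hyu : (chartAt E y₀).symm u = y := (chartAt E y₀).left_inv hy
  have h1 : MDifferentiableAt 𝓘(ℝ, E) 𝓘(ℝ, E) (chartAt E y₀).symm u :=
    ((contMDiffOn_chart_symm (I := 𝓘(ℝ, E)) (n := 2) (x := y₀)).contMDiffAt
      ((chartAt E y₀).open_target.mem_nhds ((chartAt E y₀).map_source hy))).mdifferentiableAt
      (by simp)
  rw [← hyu] at hφ hc
  rw [← mfderiv_eq_fderiv]
  have h2 := mfderiv_comp u hφ h1
  rw [show mfderiv 𝓘(ℝ, E) 𝓘(ℝ, ℝ) φ ((chartAt E y₀).symm u) = 0 from hc] at h2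
  rw [ContinuousLinearMap.zero_comp] at h2
  exact h2

end Manifold

/-! ### Hessians of invariant functions along critical orbits -/

section InvariantFunction

variable {E : Type*} [NormedAddCommGroup E] [InnerProductSpace ℝ E]
  {Y : Type*} [TopologicalSpace Y] [ChartedSpace E Y] [IsManifold 𝓘(ℝ, E) 2 Y]

/-- `C²` functions on open sets have symmetric Hessians. -/
theorem hessian_symm {φ : Y → ℝ} {y : Y} (hφ : ContMDiffAt 𝓘(ℝ, E) 𝓘(ℝ, ℝ) 2 φ y) (v w : E) :
    hessian φ y v w = hessian φ y w v := by
  have h : ContDiffAt ℝ 2 (fun u : E => φ ((chartAt E y).symm u)) (chartAt E y y) :=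
    contDiffAt_comp_chart_symm (mem_chart_target E y) (by simpa using hφ)
  exact (h.isSymmSndFDerivAt (by simp)) v w

/-- If some point of the critical orbit of `y`, seen in a chart, has a Hessian which is injective on the
orthogonal complement of a finite-dimensional `D`, then the kernel of the Hessian at `y` has at most
the dimension of `D`. -/
theorem finrank_ker_hessian_le {G : Type*} [Group G] [MulAction G Y]
    (hs : ∀ g : G, ContMDiff 𝓘(ℝ, E) 𝓘(ℝ, E) 1 (fun y : Y => g • y))
    {φ : Y → ℝ} {U : Set Y} (hU : IsOpen U)
    (hUG : ∀ (g : G), ∀ y ∈ U, g • y ∈ U) (hφG : ∀ (g : G), ∀ y ∈ U, φ (g • y) = φ y)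
    (hφ : ∀ y ∈ U, ContMDiffAt 𝓘(ℝ, E) 𝓘(ℝ, ℝ) 2 φ y) {y y₀ : Y} (hy : y ∈ U)
    (hc : IsCritical E φ y) {g : G} (hg : g • y ∈ (chartAt E y₀).source)
    {D : Submodule ℝ E} [FiniteDimensional ℝ D]
    (hD : ∀ v ∈ Dᗮ, (∀ w, fderiv ℝ (fderiv ℝ (fun u : E => φ ((chartAt E y₀).symm u)))
      (chartAt E y₀ (g • y)) v w = 0) → v = 0) :
    Module.finrank ℝ (hessian (E := E) φ y).ker ≤ Module.finrank ℝ D := by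
  set e := chartAt E y₀ with he
  set c := chartAt E y with hcdef
  set q := c y with hq
  -- `θ` is the action of `g` read from the chart at `y` to the chart at `y₀`, and `η` is its local
  -- inverse, so the derivative of `θ` at `q` is bijective.
  set θ : E → E := fun u => e (g • c.symm u) with hθdef
  set η : E → E := fun u => c (g⁻¹ • e.symm u) with hηdef
  have hcy : c.symm q = y := c.left_inv (mem_chart_source E y)
  have hθq : θ q = e (g • y) := by simp [θ, hcy]
  have hey : e.symm (e (g • y)) = g • y := e.left_inv hg
  have hηq : η (θ q) = q := by
    simp only [η]
    rw [hθq, hey, inv_smul_smul]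
  have hcsymm : ContMDiffAt 𝓘(ℝ, E) 𝓘(ℝ, E) 1 c.symm q :=
    (contMDiffOn_chart_symm (I := 𝓘(ℝ, E)) (n := 2) (x := y)).contMDiffAt
      (c.open_target.mem_nhds (mem_chart_target E y)) |>.of_le (by norm_num)
  have hesymm : ContMDiffAt 𝓘(ℝ, E) 𝓘(ℝ, E) 1 e.symm (θ q) :=
    (contMDiffOn_chart_symm (I := 𝓘(ℝ, E)) (n := 2) (x := y₀)).contMDiffAt
      (e.open_target.mem_nhds (by rw [hθq]; exact e.map_source hg)) |>.of_le (by norm_num)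
  have hec : ContMDiffAt 𝓘(ℝ, E) 𝓘(ℝ, E) 1 e (g • y) :=
    (contMDiffOn_chart (I := 𝓘(ℝ, E)) (n := 2) (x := y₀)).contMDiffAt
      (e.open_source.mem_nhds hg) |>.of_le (by norm_num)
  have hcc : ContMDiffAt 𝓘(ℝ, E) 𝓘(ℝ, E) 1 c y :=
    (contMDiffOn_chart (I := 𝓘(ℝ, E)) (n := 2) (x := y)).contMDiffAt
      (chart_source_mem_nhds E y) |>.of_le (by norm_num)
  have hsm : ContMDiffAt 𝓘(ℝ, E) 𝓘(ℝ, E) 1 (fun u => g • c.symm u) q :=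
    (hs g _).comp q hcsymm
  have hsm' : ContMDiffAt 𝓘(ℝ, E) 𝓘(ℝ, E) 1 (fun u => g⁻¹ • e.symm u) (θ q) :=
    (hs g⁻¹ _).comp (θ q) hesymm
  have hθ : ContDiffAt ℝ 1 θ q := by
    rw [← contMDiffAt_iff_contDiffAt]
    exact ContMDiffAt.comp q (by rw [hcy]; exact hec) hsm
  have hη : ContDiffAt ℝ 1 η (θ q) := by
    rw [← contMDiffAt_iff_contDiffAt]
    refine ContMDiffAt.comp (θ q) ?_ hsm'
    rw [hθq, hey, inv_smul_smul]
    exact hcc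
  have hθη : ∀ᶠ u in 𝓝 (θ q), θ (η u) = u := by
    have h1 : ∀ᶠ u in 𝓝 (θ q), g⁻¹ • e.symm u ∈ c.source := by
      refine hsm'.continuousAt.eventually (c.open_source.mem_nhds ?_)
      simp only [hθq, hey, inv_smul_smul]
      exact mem_chart_source E y
    have h2 : ∀ᶠ u in 𝓝 (θ q), u ∈ e.target :=
      e.open_target.mem_nhds (by rw [hθq]; exact e.map_source hg)
    filter_upwards [h1, h2] with u hu hu'
    simp only [θ, η]
    rw [c.left_inv hu, smul_inv_smul, e.right_inv hu']
  have hsurj : Function.Surjective (fderiv ℝ θ q) := by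
    intro w
    have h1 : HasFDerivAt (fun u => θ (η u)) ((fderiv ℝ θ q).comp (fderiv ℝ η (θ q))) (θ q) := by
      refine HasFDerivAt.comp (g := θ) (θ q) ?_ (hη.differentiableAt (by simp)).hasFDerivAt
      rw [hηq]
      exact (hθ.differentiableAt (by simp)).hasFDerivAt
    have h2 : HasFDerivAt (fun u => θ (η u)) (ContinuousLinearMap.id ℝ E) (θ q) :=
      (hasFDerivAt_id _).congr_of_eventuallyEq hθη
    exact ⟨fderiv ℝ η (θ q) w, congrArg (fun l => l w) (h1.unique h2)⟩
  have hηθ : ∀ᶠ u in 𝓝 q, η (θ u) = u := by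
    have h1 : ∀ᶠ u in 𝓝 q, g • c.symm u ∈ e.source := by
      refine hsm.continuousAt.eventually (e.open_source.mem_nhds ?_)
      simp only [hcy]
      exact hg
    filter_upwards [h1, c.open_target.mem_nhds (mem_chart_target E y)] with u hu hu'
    simp only [θ, η]
    rw [e.left_inv hu, inv_smul_smul, c.right_inv hu']
  have hinj : ∀ v, fderiv ℝ θ q v = 0 → v = 0 := by
    intro v hv
    have h1 : HasFDerivAt (fun u => η (θ u)) ((fderiv ℝ η (θ q)).comp (fderiv ℝ θ q)) q :=
      HasFDerivAt.comp q (hη.differentiableAt (by simp)).hasFDerivAt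
        (hθ.differentiableAt (by simp)).hasFDerivAt
    have h2 : HasFDerivAt (fun u => η (θ u)) (ContinuousLinearMap.id ℝ E) q :=
      (hasFDerivAt_id _).congr_of_eventuallyEq hηθ
    have h3 := congrArg (fun l => l v) (h1.unique h2)
    simpa [hv] using h3.symm
  have hgy : g • y ∈ U := hUG g y hy
  have hcd : ContDiffAt ℝ 2 (fun u : E => φ (e.symm u)) (θ q) := by
    rw [hθq]
    refine contDiffAt_comp_chart_symm (e.map_source hg) ?_
    rw [hey]
    exact hφ _ hgy
  have hcrit : fderiv ℝ (fun u : E => φ (e.symm u)) (θ q) = 0 := by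
    rw [hθq]
    exact fderiv_comp_chart_symm_eq_zero hg ((hφ _ hgy).mdifferentiableAt (by simp))
      (hc.smul hs hU hUG hφG hy ((hφ y hy).mdifferentiableAt (by simp)) _)
  have hev : (fun u : E => φ (c.symm u)) =ᶠ[𝓝 q] fun u => φ (e.symm (θ u)) := by
    have h1 : ∀ᶠ u in 𝓝 q, g • c.symm u ∈ e.source := by
      refine hsm.continuousAt.eventually (e.open_source.mem_nhds ?_)
      simp only [hcy]
      exact hg
    have h2 : ∀ᶠ u in 𝓝 q, c.symm u ∈ U :=
      hcsymm.continuousAt.eventually (hU.mem_nhds (by rw [hcy]; exact hy))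
    filter_upwards [h1, h2] with u hu hu'
    simp only [θ]
    rw [e.left_inv hu, hφG g _ hu']
  have hhess : ∀ v w, hessian φ y v w = fderiv ℝ (fderiv ℝ (fun u : E => φ (e.symm u)))
      (e (g • y)) (fderiv ℝ θ q v) (fderiv ℝ θ q w) := by
    intro v w
    rw [← hθq, ← fderiv_fderiv_comp_of_critical hθ hcd hcrit]
    change fderiv ℝ (fderiv ℝ (fun u : E => φ (c.symm u))) q v w = _
    rw [hev.fderiv.fderiv_eq]
  -- The derivative of `θ` carries kernel vectors at `y` to kernel vectors at `g • y`. None of these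
  -- but zero lies in `Dᗮ`, so projecting to `D` loses nothing.
  let T : (hessian (E := E) φ y).ker →ₗ[ℝ] D :=
    ((D.orthogonalProjectionOnto.comp (fderiv ℝ θ q) : E →L[ℝ] D) : E →ₗ[ℝ] D) ∘ₗ
      (hessian (E := E) φ y).ker.subtype
  refine LinearMap.finrank_le_finrank_of_injective (f := T) ?_
  rw [injective_iff_map_eq_zero]
  rintro ⟨v, hv⟩ hTv
  have hTv' : D.orthogonalProjectionOnto (fderiv ℝ θ q v) = 0 := hTv
  have h1 : fderiv ℝ θ q v ∈ Dᗮ := by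
    rwa [Submodule.orthogonalProjectionOnto_eq_zero_iff] at hTv'
  have h2 : fderiv ℝ θ q v = 0 := by
    refine hD _ h1 fun w => ?_
    obtain ⟨w, rfl⟩ := hsurj w
    rw [← hhess]
    exact congrArg (fun l : E →L[ℝ] ℝ => l w) hv
  exact Subtype.ext (hinj v h2)

variable (EG : Type*) [NormedAddCommGroup EG] [NormedSpace ℝ EG]
  {G : Type*} [TopologicalSpace G] [ChartedSpace EG G] [Group G]
  [MulAction G Y] {φ : Y → ℝ} {U : Set Y}

/-- The tangent space to a critical orbit lies in the kernel of the Hessian. -/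
theorem hessian_eq_zero_of_mem_orbitTangent [ContMDiffSMul 𝓘(ℝ, EG) 𝓘(ℝ, E) 1 G Y] (hU : IsOpen U)
    (hUG : ∀ (g : G), ∀ y ∈ U, g • y ∈ U) (hφG : ∀ (g : G), ∀ y ∈ U, φ (g • y) = φ y)
    (hφ : ∀ y ∈ U, ContMDiffAt 𝓘(ℝ, E) 𝓘(ℝ, ℝ) 2 φ y) {y : Y} (hy : y ∈ U)
    (hc : IsCritical E φ y) {v : E} (hv : v ∈ orbitTangent (E := E) G EG y) :
    hessian φ y v = 0 := by
  obtain ⟨ξ, rfl⟩ := hv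
  set o : EG → E := fun t => chartAction E EG G y (t, chartAt E y y) with ho
  set t₀ := chartAt EG (1 : G) 1
  have hd : HasFDerivAt o (orbitDifferential (EG := EG) (E := E) G y) t₀ :=
    hasFDerivAt_chartAction_left E EG G y
  have hsymm : (chartAt EG (1 : G)).symm t₀ = 1 := by simp [t₀]
  have ho0 : o t₀ = chartAt E y y := by simp [o, chartAction, hsymm]
  have hcont : ContinuousAt (fun t => (chartAt EG (1 : G)).symm t • y) t₀ := by
    have h1 : ContinuousAt (fun g : G => g • y) ((chartAt EG (1 : G)).symm t₀) :=
      ((contMDiff_smul_of_group EG E G Y).continuous.comp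
        (Continuous.prodMk_left y)).continuousAt
    exact ContinuousAt.comp' (f := (chartAt EG (1 : G)).symm) h1
      ((chartAt EG (1 : G)).continuousAt_symm (mem_chart_target EG 1))
  -- The whole orbit is critical, so the differential of `φ` in the chart vanishes along `o`;
  -- differentiating this identity at `t₀` gives the claim.
  have hzero : ∀ᶠ t in 𝓝 t₀,
      fderiv ℝ (fun u : E => φ ((chartAt E y).symm u)) (o t) = 0 := by
    have h1 : (chartAt E y).source ∈ 𝓝 ((chartAt EG (1 : G)).symm t₀ • y) := by
      rw [hsymm, one_smul]
      exact chart_source_mem_nhds E y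
    filter_upwards [hcont.eventually h1] with t ht
    have h2 : o t = chartAt E y ((chartAt EG (1 : G)).symm t • y) := by simp [o, chartAction]
    rw [h2]
    exact fderiv_comp_chart_symm_eq_zero ht ((hφ _ (hUG _ y hy)).mdifferentiableAt (by simp))
      (hc.smul (contMDiff_smul_left EG E) hU hUG hφG hy ((hφ y hy).mdifferentiableAt (by simp)) _)
  have hcd : ContDiffAt ℝ 2 (fun u : E => φ ((chartAt E y).symm u)) (o t₀) := by
    rw [ho0]
    exact contDiffAt_comp_chart_symm (mem_chart_target E y) (by simpa using hφ y hy)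
  have hH := (((hcd.fderiv_right (m := 1) (by norm_num)).differentiableAt
    (by simp)).hasFDerivAt).comp t₀ hd
  have h0 : HasFDerivAt (fun t => fderiv ℝ (fun u : E => φ ((chartAt E y).symm u)) (o t))
      (0 : EG →L[ℝ] E →L[ℝ] ℝ) t₀ := (hasFDerivAt_const 0 t₀).congr_of_eventuallyEq hzero
  have h := congrArg (fun l => l ξ) (hH.unique h0)
  rw [ho0] at h
  exact h

/-- If the Hessian at a critical point is Fredholm with kernel of dimension at most that of the orbit,
the critical point is `G`-nondegenerate. -/
theorem isGNondegenerateAt_of_finrank_ker_le [CompleteSpace E] [FiniteDimensional ℝ EG] {y : Y}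
    (hφ : ContMDiffAt 𝓘(ℝ, E) 𝓘(ℝ, ℝ) 2 φ y) (hF : (hessian (E := E) φ y).IsFredholm)
    (hD : ∀ v ∈ orbitTangent (E := E) G EG y, hessian φ y v = 0)
    (hle : Module.finrank ℝ (hessian (E := E) φ y).ker ≤
      Module.finrank ℝ (orbitTangent (E := E) G EG y)) :
    IsGNondegenerateAt G EG E φ y := by
  have : FiniteDimensional ℝ (orbitTangent (E := E) G EG y) :=
    LinearMap.finiteDimensional_range _
  have := hF.finite_ker
  have heq : orbitTangent (E := E) G EG y = (hessian (E := E) φ y).ker :=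
    Submodule.eq_of_le_of_finrank_le hD hle
  refine ⟨(orbitTangent (E := E) G EG y)ᗮ, Submodule.isClosed_orthogonal _,
    Submodule.isCompl_orthogonal _, ?_⟩
  refine stronglyNondegenerateOn_orthogonal (hessian_symm hφ) hF.isClosed_range fun v => ?_
  rw [heq]
  exact Iff.rfl

end InvariantFunction

/-! ### Slices to orbits -/

section Slice

variable {E : Type*} [NormedAddCommGroup E] [InnerProductSpace ℝ E] [CompleteSpace E]
  {Y : Type*} [TopologicalSpace Y] [ChartedSpace E Y]
  {EG : Type*} [NormedAddCommGroup EG] [NormedSpace ℝ EG] [FiniteDimensional ℝ EG]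
  {G : Type*} [TopologicalSpace G] [ChartedSpace EG G] [Group G]
  [MulAction G Y] [ContMDiffSMul 𝓘(ℝ, EG) 𝓘(ℝ, E) 1 G Y]

variable (EG G) in
/-- Every orbit near `y₀` meets, near `y₀`, the slice orthogonal to the orbit of `y₀`. -/
theorem eventually_exists_smul_mem_slice (y₀ : Y) {V : Set E} (hV : V ∈ 𝓝 (chartAt E y₀ y₀)) :
    ∀ᶠ y in 𝓝 y₀, ∃ g : G, g • y ∈ (chartAt E y₀).source ∧ chartAt E y₀ (g • y) ∈ V ∧
      chartAt E y₀ (g • y) - chartAt E y₀ y₀ ∈ (orbitTangent (E := E) G EG y₀)ᗮ := by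
  set D := orbitTangent (E := E) G EG y₀ with hD
  have : FiniteDimensional ℝ D := LinearMap.finiteDimensional_range _
  set t₀ := chartAt EG (1 : G) 1 with ht₀
  set u₀ := chartAt E y₀ y₀ with hu₀
  set Ψ := chartAction E EG G y₀ with hΨ
  have hΨd : ContDiffAt ℝ 1 Ψ (t₀, u₀) := contDiffAt_chartAction E EG G y₀
  have hΨs : HasStrictFDerivAt Ψ (fderiv ℝ Ψ (t₀, u₀)) (t₀, u₀) :=
    hΨd.hasStrictFDerivAt (by simp)
  have hΨ0 : Ψ (t₀, u₀) = u₀ := by simp [Ψ, chartAction, t₀, u₀]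
  have hleft : ∀ ξ, fderiv ℝ Ψ (t₀, u₀) (ξ, 0) = orbitDifferential (EG := EG) (E := E) G y₀ ξ := by
    intro ξ
    have h1 : HasFDerivAt (fun t => Ψ (t, u₀)) _ t₀ :=
      HasFDerivAt.comp (g := Ψ) t₀ hΨs.hasFDerivAt (hasFDerivAt_prodMk_left t₀ u₀)
    exact congrArg (fun l => l ξ) (h1.unique (hasFDerivAt_chartAction_left E EG G y₀))
  -- The condition is `χ (t, u) = (0, u)`. The orbit differential maps onto `D`, so `χ` is a
  -- submersion at `(t₀, u₀)` and hits every point near `(0, u₀)`; stabilisers may be of positive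
  -- dimension.
  let χ : EG × E → D × E := fun q => (D.orthogonalProjectionOnto (Ψ q - u₀), q.2)
  have hχ0 : χ (t₀, u₀) = (0, u₀) := by simp [χ, hΨ0]
  have hχ : HasStrictFDerivAt χ ((D.orthogonalProjectionOnto.comp (fderiv ℝ Ψ (t₀, u₀))).prod
      (ContinuousLinearMap.snd ℝ EG E)) (t₀, u₀) :=
    (D.orthogonalProjectionOnto.hasStrictFDerivAt.comp (t₀, u₀) (hΨs.sub_const u₀)).prodMk
      hasStrictFDerivAt_snd
  have hsurj : ((D.orthogonalProjectionOnto.comp (fderiv ℝ Ψ (t₀, u₀))).prod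
      (ContinuousLinearMap.snd ℝ EG E)).range = ⊤ := by
    refine LinearMap.range_eq_top.2 ?_
    rintro ⟨d, u⟩
    obtain ⟨ξ, hξ⟩ : ((d - D.orthogonalProjectionOnto (fderiv ℝ Ψ (t₀, u₀) (0, u)) : D) : E) ∈ D :=
      Subtype.mem _
    refine ⟨(ξ, u), ?_⟩
    have h1 : fderiv ℝ Ψ (t₀, u₀) (ξ, u) =
        fderiv ℝ Ψ (t₀, u₀) (ξ, 0) + fderiv ℝ Ψ (t₀, u₀) (0, u) := by
      rw [← map_add]; simp
    have h2 : D.orthogonalProjectionOnto (orbitDifferential (EG := EG) (E := E) G y₀ ξ) =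
        d - D.orthogonalProjectionOnto (fderiv ℝ Ψ (t₀, u₀) (0, u)) := by
      have h3 : orbitDifferential (EG := EG) (E := E) G y₀ ξ = _ := hξ
      rw [h3]
      exact Submodule.orthogonalProjectionOnto_mem_subspace_eq_self _
    change (D.orthogonalProjectionOnto (fderiv ℝ Ψ (t₀, u₀) (ξ, u)), u) = (d, u)
    rw [h1, map_add, hleft, h2]
    simp
  have : CompleteSpace EG := FiniteDimensional.complete ℝ EG
  have hmap := hχ.map_nhds_eq_of_surj hsurj
  rw [hχ0] at hmap
  have hN : ∀ᶠ q in 𝓝 (t₀, u₀), (chartAt EG (1 : G)).symm q.1 • (chartAt E y₀).symm q.2 ∈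
      (chartAt E y₀).source ∧ Ψ q ∈ V := by
    refine Filter.Eventually.and ?_ (hΨd.continuousAt.eventually (by rwa [hΨ0]))
    have h1 : ContinuousAt (fun q : EG × E =>
        ((chartAt EG (1 : G)).symm q.1, (chartAt E y₀).symm q.2)) (t₀, u₀) := by
      refine ContinuousAt.prodMap' ?_ ?_
      · exact (chartAt EG (1 : G)).continuousAt_symm (mem_chart_target EG 1)
      · exact (chartAt E y₀).continuousAt_symm (mem_chart_target E y₀)
    have h2 := ContinuousAt.comp (g := fun p : G × Y => p.1 • p.2)
      (contMDiff_smul_of_group EG E G Y).continuous.continuousAt h1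
    refine h2.eventually ((chartAt E y₀).open_source.mem_nhds ?_)
    simp [t₀, u₀]
  have himg := Filter.image_mem_map (m := χ) hN
  rw [hmap] at himg
  have h1 : ∀ᶠ u in 𝓝 u₀, ((0 : D), u) ∈ χ '' {q | (chartAt EG (1 : G)).symm q.1 •
      (chartAt E y₀).symm q.2 ∈ (chartAt E y₀).source ∧ Ψ q ∈ V} :=
    (Continuous.prodMk_right (0 : D)).continuousAt.eventually himg
  have h2 := ((chartAt E y₀).continuousAt (mem_chart_source E y₀)).eventually h1
  filter_upwards [h2, chart_source_mem_nhds E y₀] with y hy hys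
  obtain ⟨⟨t, u⟩, ⟨hts, htV⟩, hχq⟩ := hy
  have hu : u = chartAt E y₀ y := congrArg Prod.snd hχq
  have hP : D.orthogonalProjectionOnto (Ψ (t, u) - u₀) = 0 := congrArg Prod.fst hχq
  have huy : (chartAt E y₀).symm u = y := by rw [hu, (chartAt E y₀).left_inv hys]
  have hΨt : Ψ (t, u) = chartAt E y₀ ((chartAt EG (1 : G)).symm t • y) := by
    simp only [Ψ, chartAction, huy]
  refine ⟨(chartAt EG (1 : G)).symm t, ?_, ?_, ?_⟩
  · simpa only [huy] using hts
  · rwa [hΨt] at htV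
  · rw [hΨt] at hP
    rwa [Submodule.orthogonalProjectionOnto_eq_zero_iff] at hP

end Slice

/-! ### Nowhere density and separability through charts -/

/-- A chart is open and continuous on its source, so an interior point of the closure upstairs would
yield a nonempty open subset of `closure S`. -/
theorem isNowhereDense_source_inter_preimage {X E : Type*} [TopologicalSpace X] [TopologicalSpace E]
    (c : OpenPartialHomeomorph X E) {S : Set E} (hS : IsNowhereDense S) :
    IsNowhereDense (c.source ∩ c ⁻¹' S) := by
  set T := c.source ∩ c ⁻¹' S with hT
  rw [IsNowhereDense, eq_empty_iff_forall_notMem]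
  intro x hx
  obtain ⟨z, hz, hzT⟩ := mem_closure_iff.1 (interior_subset hx) _ isOpen_interior hx
  have hO : IsOpen (c '' (c.source ∩ interior (closure T))) :=
    c.isOpen_image_source_inter isOpen_interior
  have hsub : c '' (c.source ∩ interior (closure T)) ⊆ closure S := by
    rintro _ ⟨w, ⟨hw, hwT⟩, rfl⟩
    have h1 : c w ∈ closure (c '' T) :=
      (c.continuousAt hw).continuousWithinAt.mem_closure_image (interior_subset hwT)
    refine closure_mono ?_ h1
    rintro _ ⟨v, hv, rfl⟩
    exact hv.2
  have h2 : c z ∈ interior (closure S) := interior_maximal hsub hO ⟨z, ⟨hzT.1, hz⟩, rfl⟩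
  rw [hS] at h2
  exact h2

/-- A normed space on which a nonempty separable space is modelled is separable. -/
theorem separableSpace_model (E X : Type*) [NormedAddCommGroup E] [NormedSpace ℝ E]
    [TopologicalSpace X] [ChartedSpace E X] [TopologicalSpace.SeparableSpace X] [Nonempty X] :
    TopologicalSpace.SeparableSpace E := by
  obtain ⟨x⟩ := ‹Nonempty X›
  set c := chartAt E x
  obtain ⟨s, hs, hd⟩ := TopologicalSpace.exists_countable_dense X
  have hsep : TopologicalSpace.IsSeparable c.target := by
    refine ⟨c '' (s ∩ c.source), (hs.mono inter_subset_left).image _, ?_⟩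
    intro u hu
    have h1 : c.symm u ∈ closure (s ∩ c.source) := by
      rw [inter_comm]
      exact c.open_source.inter_closure ⟨c.map_target hu, hd _⟩
    have h2 := (c.continuousAt (c.map_target hu)).continuousWithinAt.mem_closure_image h1
    rwa [c.right_inv hu] at h2
  -- A nonempty open set spans, and the span of a separable set is separable.
  have htop : Submodule.span ℝ c.target = ⊤ := by
    apply Submodule.eq_top_of_nonempty_interior'
    refine ⟨c x, interior_mono Submodule.subset_span ?_⟩
    rw [c.open_target.interior_eq]
    exact mem_chart_target E x
  have h := hsep.span (R := ℝ)
  rw [htop] at h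
  exact TopologicalSpace.isSeparable_univ_iff.1 h

/-! ### Families of functions in charts and the mixed derivative -/

section Family

variable {EX : Type*} [NormedAddCommGroup EX] [NormedSpace ℝ EX]
  {X : Type*} [TopologicalSpace X] [ChartedSpace EX X]
  {EY : Type*} [NormedAddCommGroup EY] [NormedSpace ℝ EY]
  {Y : Type*} [TopologicalSpace Y] [ChartedSpace EY Y]

/-- A function on `X × Y` read in the preferred charts at `x₀` and `y₀`. -/
def readInCharts (EX EY : Type*) [TopologicalSpace EX] [ChartedSpace EX X] [TopologicalSpace EY]
    [ChartedSpace EY Y] (f : X × Y → ℝ) (x₀ : X) (y₀ : Y) (q : EX × EY) : ℝ :=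
  f ((chartAt EX x₀).symm q.1, (chartAt EY y₀).symm q.2)

variable {f : X × Y → ℝ}

theorem contMDiffAt_section_right {x : X} {y : Y}
    (hf : ContMDiffAt (𝓘(ℝ, EX).prod 𝓘(ℝ, EY)) 𝓘(ℝ, ℝ) 2 f (x, y)) :
    ContMDiffAt 𝓘(ℝ, EY) 𝓘(ℝ, ℝ) 2 (fun y => f (x, y)) y :=
  ContMDiffAt.comp (g := f) y hf (contMDiffAt_const.prodMk contMDiffAt_id)

variable [IsManifold 𝓘(ℝ, EX) 2 X] [IsManifold 𝓘(ℝ, EY) 2 Y]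

theorem contDiffAt_readInCharts {x₀ : X} {y₀ : Y} {p : EX} {u : EY}
    (hp : p ∈ (chartAt EX x₀).target) (hu : u ∈ (chartAt EY y₀).target)
    (hf : ContMDiffAt (𝓘(ℝ, EX).prod 𝓘(ℝ, EY)) 𝓘(ℝ, ℝ) 2 f
      ((chartAt EX x₀).symm p, (chartAt EY y₀).symm u)) :
    ContDiffAt ℝ 2 (readInCharts EX EY f x₀ y₀) (p, u) := by
  rw [← contMDiffAt_iff_contDiffAt]
  have h1 : ContMDiffAt 𝓘(ℝ, EX) 𝓘(ℝ, EX) 2 (chartAt EX x₀).symm p :=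
    (contMDiffOn_chart_symm (I := 𝓘(ℝ, EX)) (n := 2) (x := x₀)).contMDiffAt
      ((chartAt EX x₀).open_target.mem_nhds hp)
  have h2 : ContMDiffAt 𝓘(ℝ, EY) 𝓘(ℝ, EY) 2 (chartAt EY y₀).symm u :=
    (contMDiffOn_chart_symm (I := 𝓘(ℝ, EY)) (n := 2) (x := y₀)).contMDiffAt
      ((chartAt EY y₀).open_target.mem_nhds hu)
  have h3 : ContMDiffAt 𝓘(ℝ, EX × EY) 𝓘(ℝ, EX) 2 Prod.fst (p, u) :=
    contDiff_fst.contMDiff.contMDiffAt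
  have h4 : ContMDiffAt 𝓘(ℝ, EX × EY) 𝓘(ℝ, EY) 2 Prod.snd (p, u) :=
    contDiff_snd.contMDiff.contMDiffAt
  exact ContMDiffAt.comp (g := f) (p, u) hf ((h1.comp (p, u) h3).prodMk (h2.comp (p, u) h4))

/-- Identifies (b) with a condition on the mixed block of the second derivative in the local model.
For `x` near `x₀` the inner differential is the partial derivative of `F` at `(c x, u₀)`, always in
the chart at `y₀`. -/
theorem mixedDerivative_eq_fderiv_fderiv {A : Set (X × Y)} (hA : IsOpen A)
    (hf : ∀ z ∈ A, ContMDiffAt (𝓘(ℝ, EX).prod 𝓘(ℝ, EY)) 𝓘(ℝ, ℝ) 2 f z)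
    {x₀ : X} {y₀ : Y} (h₀ : (x₀, y₀) ∈ A) (v : EY) (w : EX) :
    mixedDerivative f x₀ y₀ v w = fderiv ℝ (fderiv ℝ (readInCharts EX EY f x₀ y₀))
      (chartAt EX x₀ x₀, chartAt EY y₀ y₀) (w, 0) (0, v) := by
  set c := chartAt EX x₀ with hc
  set u₀ := chartAt EY y₀ y₀ with hu₀
  set F := readInCharts EX EY f x₀ y₀ with hF
  have hu₀t : u₀ ∈ (chartAt EY y₀).target := mem_chart_target EY y₀
  have hsymm : (chartAt EY y₀).symm u₀ = y₀ := (chartAt EY y₀).left_inv (mem_chart_source EY y₀)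
  have hcsymm : c.symm (c x₀) = x₀ := c.left_inv (mem_chart_source EX x₀)
  have hcd : ∀ x ∈ c.source, (x, y₀) ∈ A → ContDiffAt ℝ 2 F (c x, u₀) := by
    intro x hx hxA
    refine contDiffAt_readInCharts (c.map_source hx) hu₀t ?_
    rw [c.left_inv hx, hsymm]
    exact hf _ hxA
  let ψ : EX → ℝ := fun p => fderiv ℝ F (p, u₀) (0, v)
  have hev : (fun x : X => differential (E := EY) (fun y : Y => f (x, y)) y₀ v) =ᶠ[𝓝 x₀]
      fun x => ψ (c x) := by
    have h1 : ∀ᶠ x in 𝓝 x₀, (x, y₀) ∈ A :=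
      (Continuous.prodMk_left y₀).continuousAt.eventually (hA.mem_nhds h₀)
    filter_upwards [h1, chart_source_mem_nhds EX x₀] with x hxA hx
    rw [differential_eq_fderiv ((contMDiffAt_section_right (hf _ hxA)).mdifferentiableAt (by simp))]
    have h2 : (fun u : EY => f (x, (chartAt EY y₀).symm u)) = fun u => F (c x, u) := by
      funext u
      simp only [F, readInCharts]
      rw [c.left_inv hx]
    rw [h2, fderiv_partial_right ((hcd x hx hxA).differentiableAt (by simp))]
    simp [ψ]
  have hd : DifferentiableAt ℝ (fderiv ℝ F) (c x₀, u₀) :=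
    ((hcd x₀ (mem_chart_source EX x₀) h₀).fderiv_right (m := 1) (by norm_num)).differentiableAt
      (by simp)
  have hψ : HasFDerivAt ψ _ (c x₀) :=
    (hd.hasFDerivAt.comp (c x₀) (hasFDerivAt_prodMk_left (c x₀) u₀)).clm_apply
      (hasFDerivAt_const ((0, v) : EX × EY) (c x₀))
  have hc' : MDifferentiableAt 𝓘(ℝ, EX) 𝓘(ℝ, EX) c x₀ :=
    ((contMDiffOn_chart (I := 𝓘(ℝ, EX)) (n := 2) (x := x₀)).contMDiffAt
      (chart_source_mem_nhds EX x₀)).mdifferentiableAt (by simp)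
  have hψc : MDifferentiableAt 𝓘(ℝ, EX) 𝓘(ℝ, ℝ) (fun x => ψ (c x)) x₀ :=
    MDifferentiableAt.comp (g := ψ) x₀ hψ.differentiableAt.mdifferentiableAt hc'
  have hev2 : (fun p : EX => ψ (c (c.symm p))) =ᶠ[𝓝 (c x₀)] ψ := by
    filter_upwards [c.open_target.mem_nhds (mem_chart_target EX x₀)] with p hp
    rw [c.right_inv hp]
  have h3 : differential (E := EX)
      (fun x : X => differential (E := EY) (fun y : Y => f (x, y)) y₀ v) x₀ =
      differential (E := EX) (fun x => ψ (c x)) x₀ := hev.mfderiv_eq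
  rw [mixedDerivative, h3, differential_eq_fderiv hψc, hev2.fderiv_eq, hψ.fderiv]
  simp

end Family

/-! ### The local theorem -/

section Local

variable {EG : Type*} [NormedAddCommGroup EG] [NormedSpace ℝ EG] [FiniteDimensional ℝ EG]
  {G : Type*} [TopologicalSpace G] [ChartedSpace EG G] [Group G]
  {EX : Type*} [NormedAddCommGroup EX] [NormedSpace ℝ EX] [CompleteSpace EX]
  {X : Type*} [TopologicalSpace X] [ChartedSpace EX X] [IsManifold 𝓘(ℝ, EX) 2 X]
  {EY : Type*} [NormedAddCommGroup EY] [InnerProductSpace ℝ EY] [CompleteSpace EY]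
  {Y : Type*} [TopologicalSpace Y] [ChartedSpace EY Y] [IsManifold 𝓘(ℝ, EY) 2 Y]
  [MulAction G Y] [ContMDiffSMul 𝓘(ℝ, EG) 𝓘(ℝ, EY) 1 G Y]

/-- Near any point of `A`, the parameters with a `G`-degenerate critical point are nowhere dense. -/
theorem exists_nhds_isNowhereDense_degenerate
    (hdim : ∀ y y' : Y, Module.finrank ℝ (orbitTangent (E := EY) G EG y) =
      Module.finrank ℝ (orbitTangent (E := EY) G EG y'))
    {A : Set (X × Y)} (hA : IsOpen A)
    (hAG : ∀ (x : X) (y : Y) (g : G), (x, y) ∈ A → (x, g • y) ∈ A)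
    {f : X × Y → ℝ} (hf : ∀ z ∈ A, ContMDiffAt (𝓘(ℝ, EX).prod 𝓘(ℝ, EY)) 𝓘(ℝ, ℝ) 2 f z)
    (hfG : ∀ (x : X) (y : Y) (g : G), (x, y) ∈ A → f (x, g • y) = f (x, y))
    (hFredholm : ∀ (x₀ : X) (y₀ : Y), (x₀, y₀) ∈ A →
      IsCritical EY (fun y => f (x₀, y)) y₀ →
      (hessian (E := EY) (fun y => f (x₀, y)) y₀).IsFredholm)
    (hTransverse : ∀ (x₀ : X) (y₀ : Y), (x₀, y₀) ∈ A →
      IsCritical EY (fun y => f (x₀, y)) y₀ →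
      ∀ v : EY, hessian (E := EY) (fun y => f (x₀, y)) y₀ v = 0 →
        v ∉ orbitTangent (E := EY) G EG y₀ → ∃ w : EX, mixedDerivative f x₀ y₀ v w ≠ 0)
    {x₀ : X} {y₀ : Y} (h₀ : (x₀, y₀) ∈ A) :
    ∃ U ∈ 𝓝 x₀, ∃ V ∈ 𝓝 y₀, IsNowhereDense {x | x ∈ U ∧ ∃ y ∈ V, (x, y) ∈ A ∧
      IsCritical EY (fun y => f (x, y)) y ∧
      ¬ IsGNondegenerateAt G EG EY (fun y => f (x, y)) y} := by
  set c := chartAt EX x₀ with hcdef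
  set e := chartAt EY y₀ with hedef
  set p₀ := c x₀ with hp₀
  set u₀ := e y₀ with hu₀
  set F := readInCharts EX EY f x₀ y₀ with hFdef
  have hsec : ∀ x y, (x, y) ∈ A → ContMDiffAt 𝓘(ℝ, EY) 𝓘(ℝ, ℝ) 2 (fun y => f (x, y)) y :=
    fun x y h => contMDiffAt_section_right (hf _ h)
  have hFx : ∀ x ∈ c.source, (fun u : EY => f (x, e.symm u)) = fun u => F (c x, u) := by
    intro x hx
    funext u
    simp only [F, readInCharts]
    rw [c.left_inv hx]
  have hFcd : ∀ x ∈ c.source, ∀ y ∈ e.source, (x, y) ∈ A → ContDiffAt ℝ 2 F (c x, e y) := by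
    intro x hx y hy hxy
    refine contDiffAt_readInCharts (c.map_source hx) (e.map_source hy) ?_
    rw [c.left_inv hx, e.left_inv hy]
    exact hf _ hxy
  have hcritF : ∀ x ∈ c.source, ∀ y ∈ e.source, (x, y) ∈ A →
      IsCritical EY (fun y => f (x, y)) y → ∀ w, fderiv ℝ F (c x, e y) (0, w) = 0 := by
    intro x hx y hy hxy hc w
    have h1 := fderiv_comp_chart_symm_eq_zero hy ((hsec x y hxy).mdifferentiableAt (by simp)) hc
    rw [← hedef, hFx x hx,
      fderiv_partial_right ((hFcd x hx y hy hxy).differentiableAt (by simp))] at h1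
    exact congrArg (fun l => l w) h1
  have hx₀ : x₀ ∈ c.source := mem_chart_source EX x₀
  have hy₀ : y₀ ∈ e.source := mem_chart_source EY y₀
  have hF₀ : ContDiffAt ℝ 2 F (p₀, u₀) := hFcd x₀ hx₀ y₀ hy₀ h₀
  by_cases hcrit : IsCritical EY (fun y => f (x₀, y)) y₀
  swap
  -- Noncriticality is an open condition on the pair `(x, y)`, so here the bad set is empty.
  · have hne : (fderiv ℝ F (p₀, u₀)).comp (ContinuousLinearMap.inr ℝ EX EY) ≠ 0 := by
      intro h
      apply hcrit
      rw [IsCritical, differential_eq_fderiv ((hsec _ _ h₀).mdifferentiableAt (by simp)), ← hedef,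
        hFx x₀ hx₀, fderiv_partial_right (hF₀.differentiableAt (by simp))]
      exact h
    have hcont : ContinuousAt (fun z : X × Y => (fderiv ℝ F (c z.1, e z.2)).comp
        (ContinuousLinearMap.inr ℝ EX EY)) (x₀, y₀) := by
      have h1 : ContinuousAt (fun z : X × Y => (c z.1, e z.2)) (x₀, y₀) :=
        ContinuousAt.prodMap' (c.continuousAt hx₀) (e.continuousAt hy₀)
      have h2 : ContinuousAt (fderiv ℝ F) (p₀, u₀) := hF₀.continuousAt_fderiv (by simp)
      exact (ContinuousAt.comp (f := fun z : X × Y => (c z.1, e z.2)) (g := fderiv ℝ F)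
        (x := (x₀, y₀)) h2 h1).clm_comp continuousAt_const
    have hev := hcont.eventually (isOpen_ne.mem_nhds hne)
    rw [nhds_prod_eq, Filter.eventually_prod_iff] at hev
    obtain ⟨pa, hpa, pb, hpb, hab⟩ := hev
    refine ⟨_, Filter.inter_mem hpa (chart_source_mem_nhds EX x₀), _,
      Filter.inter_mem hpb (chart_source_mem_nhds EY y₀), ?_⟩
    convert isNowhereDense_empty
    rw [eq_empty_iff_forall_notMem]
    rintro x ⟨⟨hx, hxs⟩, y, ⟨hy, hys⟩, hxy, hc, -⟩
    refine hab hx hy ?_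
    ext w
    exact hcritF x hxs y hys hxy hc w
  have hopen : ∀ x, IsOpen {y | (x, y) ∈ A} := fun x => hA.preimage (Continuous.prodMk_right x)
  have hs : ∀ g : G, ContMDiff 𝓘(ℝ, EY) 𝓘(ℝ, EY) 1 (fun y : Y => g • y) :=
    contMDiff_smul_left EG EY
  set D := orbitTangent (E := EY) G EG y₀ with hDdef
  have hDker : ∀ x y, (x, y) ∈ A → IsCritical EY (fun y => f (x, y)) y →
      ∀ v ∈ orbitTangent (E := EY) G EG y, hessian (fun y => f (x, y)) y v = 0 := by
    intro x y hxy hc v hv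
    exact hessian_eq_zero_of_mem_orbitTangent EG (hopen x) (fun g y hy => hAG x y g hy)
      (fun g y hy => hfG x y g hy) (hsec x) hxy hc hv
  have : FiniteDimensional ℝ D := LinearMap.finiteDimensional_range _
  have hhessF : ∀ v w, hessian (fun y => f (x₀, y)) y₀ v w =
      fderiv ℝ (fderiv ℝ F) (p₀, u₀) (0, v) (0, w) := by
    intro v w
    rw [← fderiv_fderiv_partial_right hF₀, hessian, ← hedef, hFx x₀ hx₀]
  obtain ⟨U, hU, V, hV, hUV⟩ := isNowhereDense_degenerateSlice hF₀
    (hcritF x₀ hx₀ y₀ hy₀ h₀ hcrit) (D := D) hhessF (hessian_symm (hsec _ _ h₀))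
    (hFredholm _ _ h₀ hcrit) (hDker _ _ h₀ hcrit) (by
      intro v hv hvD
      obtain ⟨w, hw⟩ := hTransverse _ _ h₀ hcrit v hv hvD
      exact ⟨w, by rwa [← mixedDerivative_eq_fderiv_fderiv hA hf h₀]⟩)
  refine ⟨c.source ∩ c ⁻¹' U, Filter.inter_mem (chart_source_mem_nhds EX x₀)
    ((c.continuousAt hx₀).preimage_mem_nhds hU), _, eventually_exists_smul_mem_slice EG G y₀ hV,
    (isNowhereDense_source_inter_preimage c hUV).mono ?_⟩
  rintro x ⟨⟨hxs, hxU⟩, y, ⟨g, hgs, hgV, hgD⟩, hxy, hc, hnd⟩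
  have hgxy : (x, g • y) ∈ A := hAG x y g hxy
  have hgc : IsCritical EY (fun y => f (x, y)) (g • y) :=
    hc.smul hs (hopen x) (fun g y hy => hAG x y g hy) (fun g y hy => hfG x y g hy) hxy
      ((hsec x y hxy).mdifferentiableAt (by simp)) g
  refine ⟨hxs, hxU, e (g • y), hgV, hgD, hcritF x hxs _ hgs hgxy hgc, ?_⟩
  by_contra hcon
  refine hnd (isGNondegenerateAt_of_finrank_ker_le EG (hsec x y hxy) (hFredholm x y hxy hc)
    (hDker x y hxy hc) ?_)
  -- Constancy of the orbit dimension: the slice at `y₀` bounds the kernel by `dim D_{y₀}`, whereas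
  -- nondegeneracy at `y` requires the bound `dim D_y`.
  rw [hdim y y₀]
  refine finrank_ker_hessian_le hs (hopen x) (fun g y hy => hAG x y g hy)
    (fun g y hy => hfG x y g hy) (hsec x) hxy hc hgs ?_
  intro v hv hv0
  by_contra hne
  refine hcon ⟨v, hv, hne, fun w => ?_⟩
  rw [← hv0 w, ← fderiv_fderiv_partial_right (hFcd x hxs _ hgs hgxy), ← hedef, hFx x hxs]

end Local

/-! ### From local to generic -/

/-- A property of pairs `(x, y) ∈ A` which locally in `X × Y` fails only for a nowhere dense set of
parameters `x` holds, for generic `x`, for all `y`. -/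
theorem residual_of_locally_isNowhereDense (EX : Type*) {X Y : Type*} [NormedAddCommGroup EX]
    [NormedSpace ℝ EX] [TopologicalSpace X] [ChartedSpace EX X] [TopologicalSpace.SeparableSpace X]
    [TopologicalSpace Y] [SecondCountableTopology Y] {A : Set (X × Y)} {bad : X → Y → Prop}
    (h : ∀ x y, (x, y) ∈ A → ∃ U ∈ 𝓝 x, ∃ V ∈ 𝓝 y,
      IsNowhereDense {x | x ∈ U ∧ ∃ y ∈ V, (x, y) ∈ A ∧ bad x y}) :
    {x | ∀ y, (x, y) ∈ A → ¬ bad x y} ∈ residual X := by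
  rcases isEmpty_or_nonempty X with hX | hX
  · exact Filter.mem_of_superset Filter.univ_mem fun x => hX.elim x
  have : TopologicalSpace.SeparableSpace EX := separableSpace_model EX X
  have : SecondCountableTopology EX := UniformSpace.secondCountable_of_separable EX
  obtain ⟨s, hs, hd⟩ := TopologicalSpace.exists_countable_dense X
  -- Second countability is available only on each chart domain of `X`, so the Lindelöf argument on
  -- `A` is run one chart at a time.
  have hloc : ∀ d : X, {x | x ∈ (chartAt EX d).source → ∀ y, (x, y) ∈ A → ¬ bad x y} ∈
      residual X := by
    intro d
    have : SecondCountableTopology (chartAt EX d).source :=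
      (chartAt EX d).secondCountableTopology_source
    choose! U hU V hV hUV using h
    let S : Set ((chartAt EX d).source × Y) := {z | ((z.1 : X), z.2) ∈ A}
    obtain ⟨t, htS, htc, hcov⟩ := TopologicalSpace.countable_cover_nhdsWithin (s := S)
      (f := fun z => {z' | (z'.1 : X) ∈ U z.1 z.2 ∧ z'.2 ∈ V z.1 z.2}) (by
        intro z hz
        refine mem_nhdsWithin_of_mem_nhds (Filter.inter_mem ?_ ?_)
        · exact (continuous_subtype_val.comp continuous_fst).continuousAt.preimage_mem_nhds
            (hU _ _ hz)
        · exact continuous_snd.continuousAt.preimage_mem_nhds (hV _ _ hz))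
    have hm : ⋂ z ∈ t, {x | x ∈ U z.1 z.2 ∧ ∃ y ∈ V z.1 z.2, (x, y) ∈ A ∧ bad x y}ᶜ ∈
        residual X :=
      (countable_bInter_mem htc).2 fun z hz => (hUV _ _ (htS hz)).isMeagre
    refine Filter.mem_of_superset hm fun x hx hxd y hxy hbad => ?_
    obtain ⟨z, hz, hzU, hzV⟩ := mem_iUnion₂.1 (hcov (show (⟨x, hxd⟩, y) ∈ S from hxy))
    exact mem_iInter₂.1 hx z hz ⟨hzU, y, hzV, hxy, hbad⟩
  -- Charts at a countable dense set need not cover `X`, but their union is open and dense, which is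
  -- enough for a generic statement.
  have hD : (⋃ d ∈ s, (chartAt EX d).source) ∈ residual X := by
    refine residual_of_dense_open
      (isOpen_biUnion fun d _ => (chartAt EX d).open_source) (hd.mono fun d hds => ?_)
    exact mem_iUnion₂.2 ⟨d, hds, mem_chart_source EX d⟩
  filter_upwards [hD, (countable_bInter_mem hs).2 fun d _ => hloc d] with x hx hx'
  obtain ⟨d, hds, hxd⟩ := mem_iUnion₂.1 hx
  exact mem_iInter₂.1 hx' d hds hxd

end GMorse

end

theorem theorem2p6
    -- a finite-dimensional Lie group
    {EG : Type*} [NormedAddCommGroup EG] [NormedSpace ℝ EG] [FiniteDimensional ℝ EG]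
    {G : Type*} [TopologicalSpace G] [ChartedSpace EG G] [Group G] [LieGroup 𝓘(ℝ, EG) ∞ G]
    -- a separable Banach manifold and a second countable Hilbert manifold, both of class `C^k`
    (k : WithTop ℕ∞) (hk : 2 ≤ k)
    {EX : Type*} [NormedAddCommGroup EX] [NormedSpace ℝ EX] [CompleteSpace EX]
    {X : Type*} [TopologicalSpace X] [ChartedSpace EX X] [IsManifold 𝓘(ℝ, EX) k X]
    [TopologicalSpace.SeparableSpace X]
    {EY : Type*} [NormedAddCommGroup EY] [InnerProductSpace ℝ EY] [CompleteSpace EY]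
    {Y : Type*} [TopologicalSpace Y] [ChartedSpace EY Y] [IsManifold 𝓘(ℝ, EY) k Y]
    [SecondCountableTopology Y]
    -- an action of class `C^1`, all of whose orbits have the same dimension
    [MulAction G Y] [ContMDiffSMul 𝓘(ℝ, EG) 𝓘(ℝ, EY) 1 G Y]
    (hdim : ∀ y y' : Y, Module.finrank ℝ (GMorse.orbitTangent (E := EY) G EG y) =
      Module.finrank ℝ (GMorse.orbitTangent (E := EY) G EG y'))
    -- the invariant open domain and the invariant function of class `C^k`
    (A : Set (X × Y)) (hA : IsOpen A)
    (hAG : ∀ (x : X) (y : Y) (g : G), (x, y) ∈ A → (x, g • y) ∈ A)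
    (f : X × Y → ℝ)
    (hf : ContMDiffOn (𝓘(ℝ, EX).prod 𝓘(ℝ, EY)) 𝓘(ℝ, ℝ) k f A)
    (hfG : ∀ (x : X) (y : Y) (g : G), (x, y) ∈ A → f (x, g • y) = f (x, y))
    -- (a) Hessians at critical points are Fredholm
    (hFredholm : ∀ (x₀ : X) (y₀ : Y), (x₀, y₀) ∈ A →
      GMorse.IsCritical EY (fun y => f (x₀, y)) y₀ →
      (GMorse.hessian (E := EY) (fun y => f (x₀, y)) y₀).IsFredholm)
    -- (b) the transversality condition
    (hTransverse : ∀ (x₀ : X) (y₀ : Y), (x₀, y₀) ∈ A →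
      GMorse.IsCritical EY (fun y => f (x₀, y)) y₀ →
      ∀ v : EY, GMorse.hessian (E := EY) (fun y => f (x₀, y)) y₀ v = 0 →
        v ∉ GMorse.orbitTangent (E := EY) G EG y₀ →
        ∃ w : EX, GMorse.mixedDerivative f x₀ y₀ v w ≠ 0) :
    {x : (Prod.fst '' A : Set X) |
        GMorse.IsGMorseOn G EG EY (fun y => f ((x : X), y)) {y : Y | ((x : X), y) ∈ A}} ∈
      residual (Prod.fst '' A : Set X) := by
  have : IsManifold 𝓘(ℝ, EX) 2 X := IsManifold.of_le hk
  have : IsManifold 𝓘(ℝ, EY) 2 Y := IsManifold.of_le hk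
  have hf' : ∀ z ∈ A, ContMDiffAt (𝓘(ℝ, EX).prod 𝓘(ℝ, EY)) 𝓘(ℝ, ℝ) 2 f z :=
    fun z hz => (hf.contMDiffAt (hA.mem_nhds hz)).of_le hk
  have hres := GMorse.residual_of_locally_isNowhereDense EX (A := A)
    (bad := fun x y => GMorse.IsCritical EY (fun y => f (x, y)) y ∧
      ¬ GMorse.IsGNondegenerateAt G EG EY (fun y => f (x, y)) y)
    fun x y hxy => GMorse.exists_nhds_isNowhereDense_degenerate hdim hA hAG hf' hfG hFredholm
      hTransverse hxy
  have hopen : IsOpen (Prod.fst '' A) := isOpenMap_fst A hA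
  -- `Π(A)` is open in `X`, so a residual set of `X` restricts to a residual set of `Π(A)`.
  have h := tendsto_residual_of_isOpenMap continuous_subtype_val hopen.isOpenMap_subtype_val hres
  refine Filter.mem_of_superset h fun x hx y hy hc => ?_
  by_contra hnd
  exact hx y hy ⟨hc, hnd⟩
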